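/- Fix a constant $p\in(0,1)$, a positive integer $r$, pairwise distinct positive integers $k_1,\ldots,k_r$ and positive integers $m_1,\ldots,m_r$. For a graph $G$ on $[n]$ and $U\subseteq[n]$ let $\deg_G(U)$ be the number of common neighbours of $U$, that is, the number of vertices adjacent in $G$ to every vertex of $U$. Consider the binomial random graph $G=G(n,p)$. For each $i\in[r]$ let $U_{i,1},\ldots,U_{i,m_i}$ be distinct $k_i$-element sets of vertices realising the $m_i$ largest numbers of common neighbours, counted with multiplicity, among all $k_i$-element sets: $\deg_G(U_{i,1})\ge\cdots\ge\deg_G(U_{i,m_i})$, and $\deg_G(W)\le\deg_G(U_{i,m_i})$ for every other $k_i$-element set $W$ (such sets exist once $n$ is large). Then, with probability tending to $1$ as $n\to\infty$, for every such choice (that is, however ties are broken) all the sets $U_{i,j}$, $i\in[r]$, $j\in[m_i]$, are pairwise disjoint. -/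

import Mathlib

open scoped Topology

/-- The set of common neighbours in `G` of the vertices of `U`. -/
def SimpleGraph.commonNeighborSet {V : Type*} (G : SimpleGraph V) (U : Finset V) : Set V :=
  {v | ∀ u ∈ U, G.Adj u v}

/-- The number of common neighbours in `G` of the vertices of `U`. -/
noncomputable def SimpleGraph.commonDegree {V : Type*} (G : SimpleGraph V) (U : Finset V) : ℕ :=
  (G.commonNeighborSet U).ncard

/-- `U 0, …, U (m - 1)` are distinct `k`-sets of vertices, listed by non-increasing number of
common neighbours, that realise the `m` largest numbers of common neighbours (counted with
multiplicity) among all `k`-sets of vertices of `G`. Ties may be broken in any way. -/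
structure SimpleGraph.IsTopFamily {V : Type*} (G : SimpleGraph V) (k m : ℕ)
    (U : Fin m → Finset V) : Prop where
  card_eq : ∀ j, (U j).card = k
  injective : Function.Injective U
  antitone : Antitone fun j => G.commonDegree (U j)
  le_of_notMem : ∀ W : Finset V, W.card = k → W ∉ Set.range U →
    ∀ j, G.commonDegree W ≤ G.commonDegree (U j)

open MeasureTheory ProbabilityTheory

/-! ### Independence of edges and indicators of common neighbours. -/

namespace SimpleGraph

/-! For a set `A` the normalised deviation `deg(A) / p^|A| - n` is, up to boundedly many terms, a
sum over vertices of independent centred variables, and the per-vertex covariance of the deviations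
of `A` and `B` is `f(|A ∩ B|)` with `f(j) = p^(-j) - 1` (`relVar`). At scale `√(n log n)` these sums
behave like Gaussians, so the largest deviation among the roughly `n^k` sets of size `k` is about
`a_k √(n log n)` with `a_k = √(2 k f(k))`.

Suppose a `k`-set `U` and an `l`-set `W`, both near their maxima, meet in `S` with `0 < |S| = s <
l`. By a union bound the deviation of `S` is at most about `a_s √(n log n)`. The deviation of `W`
minus that of `S` is uncorrelated with that of `U` and has variance `f(l) - f(s)` per vertex, so
such a pair costs `n` to the power minus `k + (a_l - a_s)² / (2 (f(l) - f(s)))`, against about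
`n^(k+l-s)` pairs. The sum vanishes because `(a_l - a_s)² > 2 (l - s) (f(l) - f(s))`
(`lt_sq_level_sub_div`), which reduces to strict AM-GM since `f(j)/j` is strictly increasing.
`exists_level_margin` turns this into room for an `ε`.

It remains to see that members of top families are near the maximum, that is, that more than `m`
sets of size `k` exceed `(1 - ε) a_k √(n log n)` (`tendsto_few_hits`). This is a second moment
argument for hits having no exceptional nonempty proper subset: overlapping pairs are covered by the
estimate above, and disjoint pairs are asymptotically independent by a comparison of binomial tails
at nearby thresholds. -/

instance instDiscreteMeasurableSpaceOfFinite {V : Type*} [Finite V] :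
    DiscreteMeasurableSpace (SimpleGraph V) where
  forall_measurableSet S := by
    rw [← measurableEmbedding_edgeSet.measurableSet_image]
    exact (Set.toFinite _).measurableSet

/-- A function of a graph that only depends on which elements of `S` are edges. -/
def DeterminedBy {V β : Type*} (f : SimpleGraph V → β) (S : Finset (Sym2 V)) : Prop :=
  ∀ G H : SimpleGraph V, (∀ e ∈ S, e ∈ G.edgeSet ↔ e ∈ H.edgeSet) → f G = f H

section
variable {V : Type*} [Fintype V] (p : unitInterval)

/-- The random graph is the image of a product of Bernoulli coordinates, and each edge event depends
on one coordinate only. -/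
lemma iIndepFun_mem_edgeSet :
    iIndepFun (fun (e : Sym2 V) (G : SimpleGraph V) => e ∈ G.edgeSet) (binomialRandom V p) := by
  have hprob : ∀ e : Sym2 V, IsProbabilityMeasure
      (unitInterval.toNNReal p • Measure.dirac (e ∈ (Sym2.diagSet : Set (Sym2 V))ᶜ) +
        unitInterval.toNNReal (unitInterval.symm p) • Measure.dirac False) := inferInstance
  have hm : Measurable fun ω : Sym2 V → Prop => fromEdgeSet {e | ω e} := by fun_prop
  rw [binomialRandom_eq_map, setBernoulli_eq_map, Measure.map_map (by fun_prop) (by fun_prop)]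
  have h := iIndepFun_infinitePi (P := fun e : Sym2 V =>
      (unitInterval.toNNReal p • Measure.dirac (e ∈ (Sym2.diagSet : Set (Sym2 V))ᶜ) +
        unitInterval.toNNReal (unitInterval.symm p) • Measure.dirac False))
      -- The conjunct matches `fromEdgeSet`, which discards loops.
      (X := fun e ω => ω ∧ ¬ e.IsDiag) (fun e => by fun_prop)
  rw [iIndepFun_iff_measure_inter_preimage_eq_mul] at h ⊢
  intro S sets hsets
  have key : ∀ e (s : Set Prop),
      ((fromEdgeSet ∘ fun q : Sym2 V → Prop => {i | q i}) ⁻¹'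
        ((fun G : SimpleGraph V => e ∈ G.edgeSet) ⁻¹' s)) =
      (fun ω : Sym2 V → Prop => (ω e ∧ ¬ e.IsDiag : Prop)) ⁻¹' s := by
    intro e s
    ext ω
    simp [edgeSet_fromEdgeSet]
  rw [Measure.map_apply (by exact hm) (.of_discrete), Set.preimage_iInter₂]
  simp_rw [key]
  rw [h S hsets]
  refine Finset.prod_congr rfl fun e _ => ?_
  rw [Measure.map_apply (by exact hm) (.of_discrete), key]

/-- Each function factors through the restriction of the edge set to its own finite set of pairs,
and disjoint families of coordinates are independent. -/
lemma DeterminedBy.indepFun {β γ : Type*} [MeasurableSpace β] [MeasurableSpace γ]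
    {f : SimpleGraph V → β} {g : SimpleGraph V → γ} {S T : Finset (Sym2 V)}
    (hf : DeterminedBy f S) (hg : DeterminedBy g T) (hST : Disjoint S T) :
    IndepFun f g (binomialRandom V p) := by
  have h := (iIndepFun_mem_edgeSet (V := V) p).indepFun_finset S T hST
    (fun i => .of_discrete)
  -- The canonical graph with prescribed edges in `S` and none outside; it provides the
  -- factorisation.
  let ext : ∀ S : Finset (Sym2 V), (S → Prop) → SimpleGraph V := fun S x =>
    fromEdgeSet {e | ∃ he : e ∈ S, x ⟨e, he⟩}
  have hext : ∀ (S : Finset (Sym2 V)) (G : SimpleGraph V),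
      ∀ e ∈ S, e ∈ G.edgeSet ↔ e ∈ (ext S fun i => (i : Sym2 V) ∈ G.edgeSet).edgeSet := by
    intro S G e he
    have := fun h => G.not_isDiag_of_mem_edgeSet (e := e) h
    simp [ext, edgeSet_fromEdgeSet, he]
    tauto
  have h2 := h.comp (φ := fun x => f (ext S x)) (ψ := fun x => g (ext T x))
    .of_discrete .of_discrete
  have e1 : f = (fun x => f (ext S x)) ∘ fun G (i : S) => (i : Sym2 V) ∈ G.edgeSet := by
    ext G
    exact hf _ _ (hext S G)
  have e2 : g = (fun x => g (ext T x)) ∘ fun G (i : T) => (i : Sym2 V) ∈ G.edgeSet := by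
    ext G
    exact hg _ _ (hext T G)
  rw [e1, e2]
  exact h2

lemma binomialRandom_real_adj {u v : V} (h : u ≠ v) :
    (binomialRandom V p).real {G | G.Adj u v} = p := by
  have hpre : ((fromEdgeSet ∘ fun q : Sym2 V → Prop => {i | q i}) ⁻¹'
      {G : SimpleGraph V | G.Adj u v}) = Function.eval s(u, v) ⁻¹' ({True} : Set Prop) := by
    ext ω
    simp [h]
  have hm : Measurable fun ω : Sym2 V → Prop => fromEdgeSet {e | ω e} := by fun_prop
  rw [binomialRandom_eq_map, setBernoulli_eq_map, Measure.map_map (by fun_prop) (by fun_prop),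
    map_measureReal_apply (by exact hm) .of_discrete, hpre,
    ← map_measureReal_apply (by fun_prop) .of_discrete, Measure.infinitePi_map_eval]
  simp [measureReal_def, h]

end

section
variable {V : Type*} [DecidableEq V]

/-- The edges joining `v` to `A`. -/
def star (A : Finset V) (v : V) : Finset (Sym2 V) := A.image fun u => s(u, v)

lemma star_mono {A B : Finset V} (h : A ⊆ B) (v : V) : star A v ⊆ star B v :=
  Finset.image_subset_image h

lemma star_disjoint {A B : Finset V} {v w : V} (hvw : v ≠ w) (hv : v ∉ B) :
    Disjoint (star A v) (star B w) := by
  rw [Finset.disjoint_left]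
  simp only [star, Finset.mem_image, not_exists, not_and, forall_exists_index, and_imp]
  rintro e a ha rfl b hb h
  rw [Sym2.eq_iff] at h
  rcases h with ⟨_, h⟩ | ⟨h, _⟩
  · exact hvw h.symm
  · exact hv (h ▸ hb)

lemma star_disjoint_of_disjoint {A B : Finset V} (h : Disjoint A B) {v w : V} (hv : v ∉ B) :
    Disjoint (star A v) (star B w) := by
  rw [Finset.disjoint_left]
  simp only [star, Finset.mem_image, not_exists, not_and, forall_exists_index, and_imp]
  rintro e a ha rfl b hb h'
  rw [Sym2.eq_iff] at h'
  rcases h' with ⟨h', _⟩ | ⟨h', _⟩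
  · exact Finset.disjoint_left.1 h ha (h' ▸ hb)
  · exact hv (h' ▸ hb)

end

section
variable {V : Type*} [Fintype V] [DecidableEq V] (p : unitInterval)

lemma integral_prod_of_determinedBy {ι : Type*} [DecidableEq ι] {f : ι → SimpleGraph V → ℝ}
    {S : ι → Finset (Sym2 V)} (R : Finset ι) (hf : ∀ i ∈ R, DeterminedBy (f i) (S i))
    (hS : (R : Set ι).PairwiseDisjoint S) :
    ∫ G, ∏ i ∈ R, f i G ∂(binomialRandom V p) = ∏ i ∈ R, ∫ G, f i G ∂(binomialRandom V p) := by
  induction R using Finset.induction_on with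
  | empty => simp
  | insert a R ha ih =>
    simp_rw [Finset.prod_insert ha]
    rw [← ih (fun i hi => hf i (Finset.mem_insert_of_mem hi))
      (hS.subset (by simp))]
    have hR : DeterminedBy (fun G => ∏ i ∈ R, f i G) (R.biUnion S) := by
      intro G H h
      refine Finset.prod_congr rfl fun i hi => hf i (Finset.mem_insert_of_mem hi) G H
        fun e he => h e (Finset.mem_biUnion.2 ⟨i, hi, he⟩)
    have hd : Disjoint (S a) (R.biUnion S) := by
      rw [Finset.disjoint_biUnion_right]
      intro i hi
      exact hS (by simp) (by simp [hi]) (by rintro rfl; exact ha hi)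
    exact ((hf a (Finset.mem_insert_self _ _)).indepFun p hR hd).integral_fun_mul_eq_mul_integral
      (Measurable.aestronglyMeasurable .of_discrete) (Measurable.aestronglyMeasurable .of_discrete)

open Classical in
/-- The indicator of `v` being a common neighbour of `A`. -/
noncomputable def commonInd (G : SimpleGraph V) (A : Finset V) (v : V) : ℝ :=
  if ∀ u ∈ A, G.Adj u v then 1 else 0

lemma determinedBy_commonInd (A : Finset V) (v : V) :
    DeterminedBy (fun G => commonInd G A v) (star A v) := by
  intro G H h
  have : (∀ u ∈ A, G.Adj u v) ↔ ∀ u ∈ A, H.Adj u v :=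
    forall₂_congr fun u hu => h s(u, v) (Finset.mem_image_of_mem _ hu)
  classical exact if_congr this rfl rfl

lemma commonInd_nonneg (G : SimpleGraph V) (A : Finset V) (v : V) : 0 ≤ commonInd G A v := by
  unfold commonInd; split_ifs <;> norm_num

lemma commonInd_le_one (G : SimpleGraph V) (A : Finset V) (v : V) : commonInd G A v ≤ 1 := by
  unfold commonInd; split_ifs <;> norm_num

lemma commonInd_mul (G : SimpleGraph V) (A B : Finset V) (v : V) :
    commonInd G A v * commonInd G B v = commonInd G (A ∪ B) v := by
  classical
  simp only [commonInd, Finset.mem_union, or_imp, forall_and, ite_and]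
  split_ifs <;> simp

/-- The indicator is a product over the distinct, hence independent, pairs joining `v` to `A`. For
`v ∈ A` it would vanish instead. -/
lemma integral_commonInd {A : Finset V} {v : V} (hv : v ∉ A) :
    ∫ G, commonInd G A v ∂(binomialRandom V p) = (p : ℝ) ^ A.card := by
  classical
  have h : ∀ G : SimpleGraph V, commonInd G A v = ∏ u ∈ A, commonInd G {u} v := by
    intro G
    simp only [commonInd, Finset.mem_singleton, forall_eq]
    rw [Finset.prod_ite_zero]
    simp
  simp_rw [h]
  rw [integral_prod_of_determinedBy p A (S := fun u => star {u} v)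
    (fun u _ => determinedBy_commonInd {u} v)]
  · rw [Finset.prod_congr rfl (g := fun _ => (p : ℝ)), Finset.prod_const]
    intro u hu
    have huv : u ≠ v := by rintro rfl; exact hv hu
    rw [← binomialRandom_real_adj p huv, ← integral_indicator_one .of_discrete]
    congr 1
    ext G
    simp [commonInd, Set.indicator_apply]
  · intro a ha b hb hab
    refine star_disjoint_of_disjoint (by simpa using hab) ?_
    rw [Finset.mem_singleton]
    rintro rfl
    exact hv hb

lemma commonDegree_eq_sum (G : SimpleGraph V) (A : Finset V) :
    (G.commonDegree A : ℝ) = ∑ v, commonInd G A v := by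
  classical
  simp only [commonDegree, commonNeighborSet, commonInd, Finset.sum_boole]
  rw [Set.ncard_eq_toFinset_card']
  congr 2
  ext; simp

lemma commonDegree_eq_sum_compl (G : SimpleGraph V) (A : Finset V) :
    (G.commonDegree A : ℝ) = ∑ v ∈ Aᶜ, commonInd G A v := by
  rw [commonDegree_eq_sum]
  symm
  refine Finset.sum_subset (Finset.subset_univ _) fun v _ hv => ?_
  simp only [Finset.mem_compl, not_not] at hv
  rw [commonInd, if_neg]
  intro h
  exact G.loopless.irrefl v (h v hv)

end

/-- The probability that a binomial random variable takes the value `t`. -/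
noncomputable def _root_.binTerm (N : ℕ) (q : ℝ) (t : ℕ) : ℝ :=
  (N.choose t : ℝ) * q ^ t * (1 - q) ^ (N - t)

/-- The probability that a binomial random variable is at least `T`. -/
noncomputable def _root_.binTail (N : ℕ) (q : ℝ) (T : ℕ) : ℝ :=
  ∑ t ∈ Finset.Icc T N, binTerm N q t

/-! ### Exact laws of common degrees and near-independence for disjoint sets. -/

section
variable {V : Type*} [Fintype V] [DecidableEq V] (p : unitInterval)

lemma binomialRandom_real_commonInd_eq {A R I : Finset V} (hAR : Disjoint A R) (hI : I ⊆ R) :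
    (binomialRandom V p).real
      {G | ∀ v ∈ R, (commonInd G A v = 1 ↔ v ∈ I)} =
    ((p : ℝ) ^ A.card) ^ I.card * (1 - (p : ℝ) ^ A.card) ^ (R.card - I.card) := by
  classical
  have h0 : ∀ G : SimpleGraph V, ∀ v, commonInd G A v = 0 ∨ commonInd G A v = 1 := by
    intro G v
    unfold commonInd
    split_ifs <;> simp
  have h : ∀ G : SimpleGraph V, Set.indicator {G | ∀ v ∈ R, (commonInd G A v = 1 ↔ v ∈ I)} 1 G =
      ∏ v ∈ R, (if v ∈ I then commonInd G A v else 1 - commonInd G A v) := by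
    intro G
    have : ∀ v ∈ R, (if v ∈ I then commonInd G A v else 1 - commonInd G A v) =
        if (commonInd G A v = 1 ↔ v ∈ I) then (1 : ℝ) else 0 := by
      intro v _
      rcases h0 G v with h | h <;> by_cases hv : v ∈ I <;> simp [h, hv]
    rw [Finset.prod_congr rfl this, Finset.prod_ite_zero]
    simp [Set.indicator_apply]
  rw [← integral_indicator_one .of_discrete]
  simp_rw [h]
  rw [integral_prod_of_determinedBy p R (S := fun v => star A v)]
  · have hint : ∀ v ∈ R, ∫ G, (if v ∈ I then commonInd G A v else 1 - commonInd G A v)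
        ∂(binomialRandom V p) = if v ∈ I then (p : ℝ) ^ A.card else 1 - (p : ℝ) ^ A.card := by
      intro v hv
      have hvA : v ∉ A := fun h => Finset.disjoint_left.1 hAR h hv
      split_ifs
      · exact integral_commonInd p hvA
      · rw [integral_sub (integrable_const _) .of_finite, integral_commonInd p hvA]
        simp
    rw [Finset.prod_congr rfl hint, Finset.prod_ite, Finset.prod_const, Finset.prod_const]
    congr 2
    · congr 1
      ext v
      simp only [Finset.mem_filter]
      exact ⟨fun h => h.2, fun h => ⟨hI h, h⟩⟩
    · rw [← Finset.card_sdiff_of_subset hI]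
      congr 1
      ext v
      simp
  · intro v _ G H hGH
    have := determinedBy_commonInd A v G H hGH
    dsimp only at this ⊢
    rw [this]
  · intro v hv w hw hvw
    exact star_disjoint hvw fun h => Finset.disjoint_left.1 hAR h hv

/-- Decompose by the exact set `I` of common neighbours inside `R` and group by `I.card`. -/
lemma binomialRandom_real_sum_commonInd_ge {A R : Finset V} (hAR : Disjoint A R) (T : ℕ) :
    (binomialRandom V p).real {G | (T : ℝ) ≤ ∑ v ∈ R, commonInd G A v} =
      binTail R.card ((p : ℝ) ^ A.card) T := by
  classical
  set F : Finset (Finset V) := R.powerset.filter fun I => T ≤ I.card with hF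
  have h0 : ∀ G : SimpleGraph V, ∀ v, commonInd G A v = 0 ∨ commonInd G A v = 1 := by
    intro G v
    unfold commonInd
    split_ifs <;> simp
  have hsum : ∀ G : SimpleGraph V, ∑ v ∈ R, commonInd G A v =
      (R.filter fun v => commonInd G A v = 1).card := by
    intro G
    rw [← Finset.sum_boole]
    refine Finset.sum_congr rfl fun v _ => ?_
    rcases h0 G v with h | h <;> simp [h]
  have hset : {G : SimpleGraph V | (T : ℝ) ≤ ∑ v ∈ R, commonInd G A v} =
      ⋃ I ∈ F, {G | ∀ v ∈ R, (commonInd G A v = 1 ↔ v ∈ I)} := by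
    ext G
    simp only [Set.mem_ofPred_eq, Set.mem_iUnion, hF, Finset.mem_filter, Finset.mem_powerset,
      hsum, Nat.cast_le]
    constructor
    · intro h
      refine ⟨_, ⟨Finset.filter_subset _ _, h⟩, fun v hv => by simp [hv]⟩
    · rintro ⟨I, ⟨hI, hT⟩, h⟩
      refine hT.trans (Finset.card_le_card fun v hv => ?_)
      simp [hI hv, (h v (hI hv)).2 hv]
  rw [hset, measureReal_biUnion_finset]
  · rw [Finset.sum_congr rfl fun I hI => binomialRandom_real_commonInd_eq p hAR
      (Finset.mem_powerset.1 (Finset.mem_filter.1 hI).1)]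
    rw [← Finset.sum_fiberwise_of_maps_to (s := F) (t := Finset.Icc T R.card) (g := Finset.card)]
    · refine Finset.sum_congr rfl fun t ht => ?_
      rw [Finset.sum_congr rfl (g := fun _ => ((p : ℝ) ^ A.card) ^ t *
        (1 - (p : ℝ) ^ A.card) ^ (R.card - t))]
      · rw [Finset.sum_const, nsmul_eq_mul, binTerm, mul_assoc]
        congr 2
        rw [← Finset.card_powersetCard]
        congr 1
        ext I
        simp only [hF, Finset.mem_filter, Finset.mem_powerset, Finset.mem_powersetCard]
        rw [Finset.mem_Icc] at ht
        constructor
        · rintro ⟨⟨h1, _⟩, h3⟩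
          exact ⟨h1, h3⟩
        · rintro ⟨h1, rfl⟩
          exact ⟨⟨h1, ht.1⟩, rfl⟩
      · intro I hI
        rw [(Finset.mem_filter.1 hI).2]
    · intro I hI
      simp only [hF, Finset.mem_filter, Finset.mem_powerset] at hI
      exact Finset.mem_Icc.2 ⟨hI.2, Finset.card_le_card hI.1⟩
  · intro I hI J hJ hIJ
    rw [Function.onFun, Set.disjoint_left]
    intro G h1 h2
    apply hIJ
    simp only [hF, Finset.coe_filter, Finset.mem_powerset, Set.mem_ofPred_eq] at hI hJ h1 h2
    ext v
    constructor
    · intro hv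
      exact (h2 v (hI.1 hv)).1 ((h1 v (hI.1 hv)).2 hv)
    · intro hv
      exact (h1 v (hJ.1 hv)).1 ((h2 v (hJ.1 hv)).2 hv)
  · intro I _
    exact .of_discrete

lemma binomialRandom_real_commonDegree_ge (A : Finset V) (T : ℕ) :
    (binomialRandom V p).real {G | T ≤ G.commonDegree A} =
      binTail (Fintype.card V - A.card) ((p : ℝ) ^ A.card) T := by
  rw [← Finset.card_compl, ← binomialRandom_real_sum_commonInd_ge p disjoint_compl_right]
  congr 1
  ext G
  simp only [Set.mem_ofPred_eq]
  rw [← commonDegree_eq_sum_compl, Nat.cast_le]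

lemma commonDegree_le_sum_add (G : SimpleGraph V) {A B R : Finset V} (h : (A ∪ B)ᶜ ⊆ R) :
    (G.commonDegree A : ℝ) ≤ ∑ v ∈ R, commonInd G A v + B.card := by
  rw [commonDegree_eq_sum_compl]
  calc ∑ v ∈ Aᶜ, commonInd G A v ≤ ∑ v ∈ R ∪ B, commonInd G A v := by
        refine Finset.sum_le_sum_of_subset_of_nonneg (fun v hv => ?_)
          fun v _ _ => commonInd_nonneg G A v
        by_cases hB : v ∈ B
        · simp [hB]
        · exact Finset.mem_union_left _ (h (by simp_all))
    _ ≤ ∑ v ∈ R, commonInd G A v + ∑ v ∈ B, commonInd G A v := by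
        rw [← Finset.sum_union_inter]
        exact le_add_of_nonneg_right (Finset.sum_nonneg fun v _ => commonInd_nonneg G A v)
    _ ≤ _ := by
        gcongr
        exact (Finset.sum_le_sum fun v _ => commonInd_le_one G A v).trans (by simp)

/-- Edges between `A` and `B` influence both degrees. Counting only vertices outside `A ∪ B` makes
the two counts independent, at the price of lowering the thresholds by `B.card` and `A.card`. -/
lemma binomialRandom_real_commonDegree_ge_and {A B : Finset V} (hAB : Disjoint A B) (T : ℕ) :
    (binomialRandom V p).real {G | T ≤ G.commonDegree A ∧ T ≤ G.commonDegree B} ≤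
      binTail (Fintype.card V - A.card) ((p : ℝ) ^ A.card) (T - B.card) *
      binTail (Fintype.card V - B.card) ((p : ℝ) ^ B.card) (T - A.card) := by
  set R := (A ∪ B)ᶜ with hR
  have hdet : ∀ (C : Finset V) (t : ℕ),
      DeterminedBy (fun G => (t : ℝ) ≤ ∑ v ∈ R, commonInd G C v) (R.biUnion (star C)) := by
    intro C t G H h
    have : ∑ v ∈ R, commonInd G C v = ∑ v ∈ R, commonInd H C v :=
      Finset.sum_congr rfl fun v hv => determinedBy_commonInd C v G H
        fun e he => h e (Finset.mem_biUnion.2 ⟨v, hv, he⟩)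
    dsimp only
    rw [this]
  have hdisj : Disjoint (R.biUnion (star A)) (R.biUnion (star B)) := by
    simp only [Finset.disjoint_biUnion_left, Finset.disjoint_biUnion_right]
    intro w _ v hv
    refine star_disjoint_of_disjoint hAB fun h => ?_
    simp [hR, h] at hv
  have hind := (hdet A (T - B.card)).indepFun p (hdet B (T - A.card)) hdisj
  have hprod := hind.measure_inter_preimage_eq_mul {True} {True} .of_discrete .of_discrete
  have hpre : ∀ (C : Finset V) (t : ℕ),
      (fun G : SimpleGraph V => (t : ℝ) ≤ ∑ v ∈ R, commonInd G C v) ⁻¹' {True} =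
      {G | (t : ℝ) ≤ ∑ v ∈ R, commonInd G C v} := by
    intro C t; ext G; simp
  rw [hpre, hpre] at hprod
  -- Enlarging the range back to `Cᶜ` only raises the probability and keeps the same binomial law as
  -- for a single set.
  have hmono : ∀ (C : Finset V) (t : ℕ), R ⊆ Cᶜ →
      (binomialRandom V p).real {G | (t : ℝ) ≤ ∑ v ∈ R, commonInd G C v} ≤
      binTail (Fintype.card V - C.card) ((p : ℝ) ^ C.card) t := by
    intro C t hC
    rw [← Finset.card_compl, ← binomialRandom_real_sum_commonInd_ge p disjoint_compl_right]
    refine measureReal_mono fun G hG => ?_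
    exact le_trans hG (Finset.sum_le_sum_of_subset_of_nonneg hC
      fun v _ _ => commonInd_nonneg G C v)
  calc _ ≤ (binomialRandom V p).real
        ({G | ((T - B.card : ℕ) : ℝ) ≤ ∑ v ∈ R, commonInd G A v} ∩
        {G | ((T - A.card : ℕ) : ℝ) ≤ ∑ v ∈ R, commonInd G B v}) := by
        refine measureReal_mono fun G hG => ?_
        have key : ∀ {C D : Finset V}, (C ∪ D)ᶜ ⊆ R → T ≤ G.commonDegree C →
            ((T - D.card : ℕ) : ℝ) ≤ ∑ v ∈ R, commonInd G C v := by
          intro C D hCD hT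
          have h1 := commonDegree_le_sum_add G hCD
          have h2 : (T : ℝ) ≤ G.commonDegree C := by exact_mod_cast hT
          have h3 : 0 ≤ ∑ v ∈ R, commonInd G C v :=
            Finset.sum_nonneg fun v _ => commonInd_nonneg G C v
          rcases le_total D.card T with h | h
          · rw [Nat.cast_sub h]; linarith
          · rw [Nat.sub_eq_zero_of_le h]; simpa using h3
        exact ⟨key (by rw [hR]) hG.1, key (by rw [hR, Finset.union_comm]) hG.2⟩
    _ = _ := by rw [measureReal_def, hprod, ENNReal.toReal_mul]; rfl
    _ ≤ _ := mul_le_mul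
        (hmono A _ (Finset.compl_subset_compl.2 Finset.subset_union_left))
        (hmono B _ (Finset.compl_subset_compl.2 Finset.subset_union_right)) measureReal_nonneg
        (measureReal_nonneg.trans (hmono A _ (Finset.compl_subset_compl.2 Finset.subset_union_left)))
end
end SimpleGraph

/-! ### Chernoff bounds with the Gaussian exponent. -/

namespace SimpleGraph

/-- The variance of `1_E / ℙ(E)` for an event `E` of probability `p ^ j`. -/
noncomputable def relVar (p : unitInterval) (j : ℕ) : ℝ := ((p : ℝ) ^ j)⁻¹ - 1

/-- The deviation of the normalised common degree of `A` from the number of vertices. -/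
noncomputable def normDev {V : Type*} [Fintype V] (p : unitInterval) (G : SimpleGraph V)
    (A : Finset V) : ℝ :=
  (G.commonDegree A : ℝ) / (p : ℝ) ^ A.card - Fintype.card V

/-- The quadratic coefficient tends to `1 / 2` as `x → 0`, which preserves the sharp Gaussian
constant. -/
lemma exp_le_one_add_add_sq {x : ℝ} (hx : |x| ≤ 1) :
    Real.exp x ≤ 1 + x + x ^ 2 / 2 * (1 + |x|) := by
  have h := (abs_le.1 (Real.exp_bound hx (n := 3) (by norm_num))).2
  have e : ∑ m ∈ Finset.range 3, x ^ m / (m.factorial : ℝ) = 1 + x + x ^ 2 / 2 := by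
    simp [Finset.sum_range_succ]
  have h3 : |x| ^ 3 = x ^ 2 * |x| := by rw [pow_succ, sq_abs]
  rw [e, h3] at h
  norm_num at h
  nlinarith [mul_nonneg (sq_nonneg x) (abs_nonneg x)]

section
variable {V : Type*} [Fintype V] [DecidableEq V] {p : unitInterval}

/-- The product of the indicators of `A` and `B` is that of `A ∪ B`, and `|A| + |B| - |A ∪ B| = |A ∩
B|`; hence covariances depend only on the intersection. -/
lemma integral_normalized_mul (hp : 0 < p) {A B : Finset V} {v : V} (hA : v ∉ A) (hB : v ∉ B) :
    ∫ G, (commonInd G A v / (p : ℝ) ^ A.card - 1) * (commonInd G B v / (p : ℝ) ^ B.card - 1)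
      ∂(binomialRandom V p) = relVar p (A ∩ B).card := by
  have hp' : (0 : ℝ) < p := hp
  have h : ∀ G : SimpleGraph V,
      (commonInd G A v / (p : ℝ) ^ A.card - 1) * (commonInd G B v / (p : ℝ) ^ B.card - 1) =
      commonInd G (A ∪ B) v * ((p : ℝ) ^ A.card * (p : ℝ) ^ B.card)⁻¹ -
        commonInd G A v * ((p : ℝ) ^ A.card)⁻¹ - commonInd G B v * ((p : ℝ) ^ B.card)⁻¹ + 1 := by
    intro G
    rw [← commonInd_mul]
    field_simp
    ring
  simp_rw [h]
  rw [integral_add .of_finite .of_finite, integral_sub .of_finite .of_finite,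
    integral_sub .of_finite .of_finite, integral_mul_const, integral_mul_const,
    integral_mul_const, integral_commonInd p hA, integral_commonInd p hB,
    integral_commonInd p (by simp [hA, hB])]
  have hc := Finset.card_union_add_card_inter A B
  have e : (p : ℝ) ^ A.card * (p : ℝ) ^ B.card =
      (p : ℝ) ^ (A ∪ B).card * (p : ℝ) ^ (A ∩ B).card := by
    rw [← pow_add, ← pow_add, hc]
  rw [e, relVar]
  simp
  field_simp
  ring

lemma abs_normalized_le (hp : 0 < p) (G : SimpleGraph V) {A : Finset V} {K : ℕ} (hA : A.card ≤ K)
    (v : V) : |commonInd G A v / (p : ℝ) ^ A.card - 1| ≤ ((p : ℝ) ^ K)⁻¹ := by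
  have hp' : (0 : ℝ) < p := hp
  have h1 : 1 ≤ ((p : ℝ) ^ K)⁻¹ := (one_le_inv₀ (by positivity)).2 (pow_le_one₀ hp'.le p.2.2)
  have h2 : ((p : ℝ) ^ A.card)⁻¹ ≤ ((p : ℝ) ^ K)⁻¹ :=
    inv_anti₀ (by positivity) (pow_le_pow_of_le_one hp'.le p.2.2 hA)
  have h3 : 0 ≤ commonInd G A v / (p : ℝ) ^ A.card :=
    div_nonneg (commonInd_nonneg G A v) (by positivity)
  have h4 : commonInd G A v / (p : ℝ) ^ A.card ≤ ((p : ℝ) ^ A.card)⁻¹ := by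
    rw [div_eq_mul_inv]
    exact mul_le_of_le_one_left (by positivity) (commonInd_le_one G A v)
  rw [abs_le]
  constructor <;> linarith

lemma normDev_eq_sum (G : SimpleGraph V) (A : Finset V) :
    normDev p G A = ∑ v, (commonInd G A v / (p : ℝ) ^ A.card - 1) := by
  rw [normDev, commonDegree_eq_sum, Finset.sum_sub_distrib, Finset.sum_div]
  simp

variable {ι : Type*} [Fintype ι]

/-- Second-order Taylor expansion: the mean is zero, the second moment is the quadratic form in
`relVar`, and the uniform bound on the variable controls the cubic error. -/
lemma integral_exp_linear_le (hp : 0 < p) {A : ι → Finset V} {c : ι → ℝ} {K : ℕ}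
    (hK : ∀ i, (A i).card ≤ K) {v : V} (hv : ∀ i, v ∉ A i) {l : ℝ} (hl : 0 ≤ l)
    (hlC : l * ((∑ i, |c i|) * ((p : ℝ) ^ K)⁻¹) ≤ 1) :
    ∫ G, Real.exp (l * ∑ i, c i * (commonInd G (A i) v / (p : ℝ) ^ (A i).card - 1))
      ∂(binomialRandom V p) ≤
    Real.exp (l ^ 2 * (∑ i, ∑ j, c i * c j * relVar p (A i ∩ A j).card) / 2 *
      (1 + l * ((∑ i, |c i|) * ((p : ℝ) ^ K)⁻¹))) := by
  set C := (∑ i, |c i|) * ((p : ℝ) ^ K)⁻¹ with hC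
  set ψ : SimpleGraph V → ℝ :=
    fun G => ∑ i, c i * (commonInd G (A i) v / (p : ℝ) ^ (A i).card - 1) with hψ
  have hp' : (0 : ℝ) < p := hp
  have hψC : ∀ G, |ψ G| ≤ C := by
    intro G
    rw [hC, Finset.sum_mul]
    refine (Finset.abs_sum_le_sum_abs _ _).trans (Finset.sum_le_sum fun i _ => ?_)
    rw [abs_mul]
    exact mul_le_mul_of_nonneg_left (abs_normalized_le hp G (hK i) v) (abs_nonneg _)
  have hmean : ∫ G, ψ G ∂(binomialRandom V p) = 0 := by
    rw [hψ, integral_finsetSum _ fun i _ => .of_finite]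
    refine Finset.sum_eq_zero fun i _ => ?_
    rw [integral_const_mul, integral_sub .of_finite .of_finite, integral_div,
      integral_commonInd p (hv i)]
    simp [hp'.ne']
  have hsq : ∫ G, ψ G ^ 2 ∂(binomialRandom V p) =
      ∑ i, ∑ j, c i * c j * relVar p (A i ∩ A j).card := by
    simp_rw [hψ, sq, Finset.sum_mul_sum]
    rw [integral_finsetSum _ fun i _ => .of_finite]
    refine Finset.sum_congr rfl fun i _ => ?_
    rw [integral_finsetSum _ fun i _ => .of_finite]
    refine Finset.sum_congr rfl fun j _ => ?_
    simp_rw [mul_mul_mul_comm]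
    rw [integral_const_mul, integral_normalized_mul hp (hv i) (hv j)]
  have hpt : ∀ G, Real.exp (l * ψ G) ≤ 1 + l * ψ G + l ^ 2 / 2 * (1 + l * C) * ψ G ^ 2 := by
    intro G
    have habs : |l * ψ G| ≤ l * C := by
      rw [abs_mul, abs_of_nonneg hl]
      exact mul_le_mul_of_nonneg_left (hψC G) hl
    have h := exp_le_one_add_add_sq (habs.trans hlC)
    have : (l * ψ G) ^ 2 / 2 * (1 + |l * ψ G|) ≤ (l * ψ G) ^ 2 / 2 * (1 + l * C) := by gcongr
    calc _ ≤ _ := h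
      _ ≤ 1 + l * ψ G + (l * ψ G) ^ 2 / 2 * (1 + l * C) := by linarith
      _ = _ := by ring
  calc _ ≤ ∫ G, (1 + l * ψ G + l ^ 2 / 2 * (1 + l * C) * ψ G ^ 2) ∂(binomialRandom V p) :=
        integral_mono .of_finite .of_finite hpt
    _ = 1 + l ^ 2 / 2 * (1 + l * C) * ∑ i, ∑ j, c i * c j * relVar p (A i ∩ A j).card := by
        rw [integral_add .of_finite .of_finite, integral_add .of_finite .of_finite,
          integral_const_mul, integral_const_mul, hmean, hsq]
        simp
    _ ≤ _ := by
        refine le_trans (le_of_eq ?_) (Real.add_one_le_exp _)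
        ring

lemma binomialRandom_real_linear_ge_le (hp : 0 < p) {A : ι → Finset V} {c : ι → ℝ} {K : ℕ}
    (hK : ∀ i, (A i).card ≤ K) {l : ℝ} (hl : 0 ≤ l)
    (hlC : l * ((∑ i, |c i|) * ((p : ℝ) ^ K)⁻¹) ≤ 1) {Q : ℝ} (hQ0 : 0 ≤ Q)
    (hQ : ∑ i, ∑ j, c i * c j * relVar p (A i ∩ A j).card ≤ Q) (a : ℝ) :
    (binomialRandom V p).real {G | a ≤ ∑ i, c i * normDev p G (A i)} ≤
    Real.exp (-l * (a - Fintype.card ι * K * ((∑ i, |c i|) * ((p : ℝ) ^ K)⁻¹)) +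
      Fintype.card V * (l ^ 2 * Q / 2 *
      (1 + l * ((∑ i, |c i|) * ((p : ℝ) ^ K)⁻¹)))) := by
  classical
  have hp' : (0 : ℝ) < p := hp
  set C := (∑ i, |c i|) * ((p : ℝ) ^ K)⁻¹ with hC
  have hC0 : 0 ≤ C := by positivity
  set ψ : V → SimpleGraph V → ℝ :=
    fun v G => ∑ i, c i * (commonInd G (A i) v / (p : ℝ) ^ (A i).card - 1) with hψ
  have hψC : ∀ v G, |ψ v G| ≤ C := by
    intro v G
    rw [hC, Finset.sum_mul]
    refine (Finset.abs_sum_le_sum_abs _ _).trans (Finset.sum_le_sum fun i _ => ?_)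
    rw [abs_mul]
    exact mul_le_mul_of_nonneg_left (abs_normalized_le hp G (hK i) v) (abs_nonneg _)
  -- At vertices of `M` the variables need not be centred and the stars overlap; these vertices are
  -- split off and cost at most `M.card * C`.
  set M := Finset.univ.biUnion A with hM
  have hMcard : (M.card : ℝ) ≤ Fintype.card ι * K := by
    have : M.card ≤ Fintype.card ι * K :=
      Finset.card_biUnion_le_card_mul _ _ _ fun i _ => hK i
    exact_mod_cast this
  have hAM : ∀ i, A i ⊆ M := fun i => Finset.subset_biUnion_of_mem A (Finset.mem_univ i)
  have hsum : ∀ G, ∑ i, c i * normDev p G (A i) ≤ ∑ v ∈ Mᶜ, ψ v G + Fintype.card ι * K * C := by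
    intro G
    have h1 : ∑ i, c i * normDev p G (A i) = ∑ v, ψ v G := by
      simp_rw [normDev_eq_sum, Finset.mul_sum, hψ]
      exact Finset.sum_comm
    rw [h1, ← Finset.sum_compl_add_sum M]
    gcongr
    calc ∑ v ∈ M, ψ v G ≤ ∑ v ∈ M, C :=
          Finset.sum_le_sum fun v _ => (le_abs_self _).trans (hψC v G)
      _ = M.card * C := by simp
      _ ≤ _ := by gcongr
  have hdet : ∀ v ∈ Mᶜ, DeterminedBy (fun G => Real.exp (l * ψ v G)) (star M v) := by
    intro v _ G H h
    have : ψ v G = ψ v H := by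
      refine Finset.sum_congr rfl fun i _ => ?_
      have := determinedBy_commonInd (A i) v G H fun e he => h e (star_mono (hAM i) v he)
      dsimp only at this
      rw [this]
    dsimp only
    rw [this]
  have hmgf : mgf (fun G => ∑ v ∈ Mᶜ, ψ v G) (binomialRandom V p) l ≤
      Real.exp (Fintype.card V * (l ^ 2 * Q / 2 * (1 + l * C))) := by
    simp only [mgf, Finset.mul_sum, Real.exp_sum]
    rw [integral_prod_of_determinedBy p _ hdet]
    · have hv : ∀ v ∈ Mᶜ, ∫ G, Real.exp (l * ψ v G) ∂(binomialRandom V p) ≤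
          Real.exp (l ^ 2 * Q / 2 * (1 + l * C)) := by
        intro v hv
        refine (integral_exp_linear_le hp hK (fun i hi => ?_) hl hlC).trans ?_
        · simp only [Finset.mem_compl] at hv
          exact hv (hAM i hi)
        · gcongr
      calc _ ≤ ∏ v ∈ Mᶜ, Real.exp (l ^ 2 * Q / 2 * (1 + l * C)) :=
            Finset.prod_le_prod (fun v _ => integral_nonneg fun G => (Real.exp_pos _).le) hv
        _ = Real.exp ((Mᶜ).card * (l ^ 2 * Q / 2 * (1 + l * C))) := by
            rw [Finset.prod_const, ← Real.exp_nat_mul]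
        _ ≤ _ := by
            gcongr
            exact Finset.card_le_univ _
    · intro v hv w hw hvw
      exact star_disjoint hvw (by simpa using hv)
  calc _ ≤ (binomialRandom V p).real
        {G | a - Fintype.card ι * K * C ≤ ∑ v ∈ Mᶜ, ψ v G} := by
        refine measureReal_mono fun G hG => ?_
        have := hsum G
        simp only [Set.mem_ofPred_eq] at hG ⊢
        linarith
    _ ≤ Real.exp (-l * (a - Fintype.card ι * K * C)) *
        mgf (fun G => ∑ v ∈ Mᶜ, ψ v G) (binomialRandom V p) l :=
        measure_ge_le_exp_mul_mgf _ hl .of_finite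
    _ ≤ _ := by
        rw [Real.exp_add]
        gcongr
end

lemma tendsto_sqrt_log_div :
    Filter.Tendsto (fun n : ℕ => √(Real.log n / n)) Filter.atTop (𝓝 0) := by
  have h : Filter.Tendsto (fun x : ℝ => Real.log x / x) Filter.atTop (𝓝 0) :=
    Real.isLittleO_log_id_atTop.tendsto_div_nhds_zero
  simpa using (h.comp tendsto_natCast_atTop_atTop).sqrt

lemma sqrt_log_div_mul_sqrt {n : ℕ} (hn : 0 < n) :
    √(Real.log n / n) * √(n * Real.log n) = Real.log n := by
  have hlog : 0 ≤ Real.log n := Real.log_natCast_nonneg n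
  have hn' : (0 : ℝ) < n := by exact_mod_cast hn
  rw [← Real.sqrt_mul (by positivity), Real.sqrt_eq_iff_mul_self_eq (by positivity) hlog]
  field_simp

/-- A Chernoff bound for linear combinations of normalised common degrees, with the Gaussian
exponent. -/
lemma eventually_linear_ge_le {p : unitInterval} (hp : 0 < p) {ι : Type*} [Fintype ι]
    (c : ι → ℝ) (K : ℕ) {Q : ℝ} (hQ0 : 0 ≤ Q) (θ : ℝ) {η : ℝ} (hη : 0 < η) :
    ∀ᶠ n : ℕ in Filter.atTop, ∀ A : ι → Finset (Fin n), (∀ i, (A i).card ≤ K) →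
      ∑ i, ∑ j, c i * c j * relVar p (A i ∩ A j).card ≤ Q →
      (binomialRandom (Fin n) p).real
        {G | θ * √(n * Real.log n) ≤ ∑ i, c i * normDev p G (A i)} ≤
      (n : ℝ) ^ (-(θ - Q / 2 - η)) := by
  have hp' : (0 : ℝ) < p := hp
  set C := (∑ i, |c i|) * ((p : ℝ) ^ K)⁻¹ with hC
  have hC0 : 0 ≤ C := by positivity
  have h1 : ∀ᶠ n : ℕ in Filter.atTop, √(Real.log n / n) * C < 1 :=
    (tendsto_sqrt_log_div.mul_const C).eventually_lt_const (by simp)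
  have h2 : ∀ᶠ n : ℕ in Filter.atTop,
      √(Real.log n / n) * (Fintype.card ι * K * C + Q / 2 * C) < η :=
    (tendsto_sqrt_log_div.mul_const _).eventually_lt_const (by simpa using hη)
  filter_upwards [h1, h2, Filter.eventually_ge_atTop 3] with n h1 h2 hn A hK hQ
  have hn0 : (0 : ℝ) < n := by positivity
  have hlog : 1 ≤ Real.log n := by
    rw [Real.le_log_iff_exp_le hn0]
    have : (3 : ℝ) ≤ n := by exact_mod_cast hn
    linarith [Real.exp_one_lt_d9]
  -- With this tilt both `n * l ^ 2` and `l * √(n log n)` equal `log n`; any further optimisation is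
  -- left to the coefficients `c`.
  set l := √(Real.log n / n) with hl
  have hl0 : 0 ≤ l := Real.sqrt_nonneg _
  have hl2 : n * l ^ 2 = Real.log n := by
    rw [hl, Real.sq_sqrt (by positivity)]
    field_simp
  refine (binomialRandom_real_linear_ge_le hp hK hl0 h1.le hQ0 hQ _).trans ?_
  rw [Real.rpow_def_of_pos hn0, Real.exp_le_exp, Fintype.card_fin, ← hC]
  have e1 : l * √(n * Real.log n) = Real.log n := sqrt_log_div_mul_sqrt (by omega)
  have e2 : -l * (θ * √(n * Real.log n) - Fintype.card ι * K * C) +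
      n * (l ^ 2 * Q / 2 * (1 + l * C)) =
      -θ * (l * √(n * Real.log n)) + l * (Fintype.card ι * K * C) +
      (n * l ^ 2) * (Q / 2 + l * (Q / 2 * C)) := by ring
  rw [e2, e1, hl2]
  have h3 : l * (Fintype.card ι * K * C) ≤ Real.log n * (l * (Fintype.card ι * K * C)) :=
    le_mul_of_one_le_left (by positivity) hlog
  nlinarith [mul_le_mul_of_nonneg_left h2.le (zero_le_one.trans hlog)]
end SimpleGraph

/-! ### Lower bounds and regularity for binomial tails. -/

section binomial
variable {N : ℕ} {q : ℝ}

lemma binTerm_nonneg (hq0 : 0 ≤ q) (hq1 : q ≤ 1) (N t : ℕ) : 0 ≤ binTerm N q t := by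
  have := sub_nonneg.2 hq1
  unfold binTerm
  positivity

lemma binTerm_eq_zero_of_lt {t : ℕ} (h : N < t) (q : ℝ) : binTerm N q t = 0 := by
  simp [binTerm, Nat.choose_eq_zero_of_lt h]

lemma binTerm_succ (N : ℕ) (q : ℝ) (t : ℕ) :
    binTerm N q (t + 1) * ((t + 1) * (1 - q)) = binTerm N q t * ((N - t) * q) := by
  rcases le_or_gt N t with h | h
  · rw [binTerm_eq_zero_of_lt (by omega)]
    rcases h.eq_or_lt with rfl | h
    · simp
    · simp [binTerm_eq_zero_of_lt h]
  · have h1 : (N.choose (t + 1) : ℝ) * (t + 1) = N.choose t * (N - t) := by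
      have := Nat.choose_succ_right_eq N t
      rw [← Nat.cast_sub h.le]
      exact_mod_cast this
    have h2 : N - t = (N - (t + 1)) + 1 := by omega
    simp only [binTerm]
    rw [h2, pow_succ, pow_succ]
    linear_combination (q ^ t * q * (1 - q) ^ (N - (t + 1)) * (1 - q)) * h1

/-- By `binTerm_succ` the ratio of consecutive terms is `(N - t) q / ((t + 1) (1 - q))`; it is at
least `1` up to the mean, and beyond it the deficit is bounded by the distance from the mean over
the variance. -/
lemma binTerm_mul_le_succ (hq0 : 0 < q) (hq1 : q < 1) (hN : 0 < N) {y : ℝ} (hy : 0 ≤ y) {t : ℕ}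
    (ht : t ≤ N * q + y) :
    binTerm N q t * (1 - (y + 1) / (N * (q * (1 - q)))) ≤ binTerm N q (t + 1) := by
  have hq' : 0 < 1 - q := sub_pos.2 hq1
  have hN' : (0 : ℝ) < N := by exact_mod_cast hN
  have hpos : 0 < ((t : ℝ) + 1) * (1 - q) := by positivity
  refine le_of_mul_le_mul_right ?_ hpos
  rw [binTerm_succ, mul_assoc]
  refine mul_le_mul_of_nonneg_left ?_ (binTerm_nonneg hq0.le hq1.le N t)
  set z := (y + 1) / (N * (q * (1 - q))) with hz
  have hz0 : 0 ≤ z := by positivity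
  have hzN : z * (N * (q * (1 - q))) = y + 1 := by
    rw [hz]; field_simp
  rcases le_total ((N : ℝ) * q) (t + 1) with h | h
  · have : z * (N * (q * (1 - q))) ≤ z * ((t + 1) * (1 - q)) := by
      rw [← mul_assoc (N : ℝ)]
      gcongr
    nlinarith
  · have : 0 ≤ z * ((t + 1) * (1 - q)) := by positivity
    nlinarith

lemma exp_neg_add_sq_le {z : ℝ} (h0 : 0 ≤ z) (h1 : z ≤ 1 / 2) :
    Real.exp (-(z * (1 + z))) ≤ 1 - z := by
  have h := Real.quadratic_le_exp_of_nonneg (x := z * (1 + z)) (by positivity)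
  rw [Real.exp_neg, inv_le_comm₀ (Real.exp_pos _) (by linarith)]
  refine le_trans ?_ h
  rw [inv_le_iff_one_le_mul₀ (by linarith)]
  have h2 : z ^ 3 ≤ z ^ 2 / 2 := by nlinarith [sq_nonneg z]
  have h3 : z ^ 4 ≤ z ^ 2 / 4 := by nlinarith [sq_nonneg z, pow_nonneg h0 3]
  have h4 : z ^ 5 ≤ z ^ 2 / 8 := by nlinarith [sq_nonneg z, pow_nonneg h0 3, pow_nonneg h0 4]
  nlinarith [sq_nonneg z]

/-- The ratio bound is multiplied over `h` steps; the `h ^ 2 / 2` coming from summing the step index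
is the Gaussian exponent. -/
lemma binTerm_shift (hq0 : 0 < q) (hq1 : q < 1) (hN : 0 < N) {w H : ℝ} (hw : 0 ≤ w)
    (hz : (w + H + 1) / (N * (q * (1 - q))) ≤ 1 / 2) {t h : ℕ} (ht : t ≤ N * q + w)
    (hH : h ≤ H) :
    binTerm N q t * Real.exp (-((1 + (w + H + 1) / (N * (q * (1 - q)))) *
      (h * (w + 1) + (h : ℝ) ^ 2 / 2) / (N * (q * (1 - q))))) ≤ binTerm N q (t + h) := by
  have hq' : 0 < 1 - q := sub_pos.2 hq1
  have hN' : (0 : ℝ) < N := by exact_mod_cast hN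
  set v := (N : ℝ) * (q * (1 - q)) with hv
  have hv0 : 0 < v := by positivity
  set z₀ := (w + H + 1) / v with hz₀
  induction h with
  | zero => simp
  | succ i ih =>
    push_cast at hH
    have hH0 : 0 ≤ H := by linarith [(Nat.cast_nonneg i : (0 : ℝ) ≤ i)]
    have hz0 : 0 ≤ z₀ := by positivity
    have hi : (i : ℝ) ≤ H := by linarith
    have step := binTerm_mul_le_succ hq0 hq1 hN (y := w + i) (by positivity) (t := t + i)
      (by push_cast; linarith)
    rw [← hv] at step
    set z := (w + i + 1) / v with hzi
    have hzi0 : 0 ≤ z := by positivity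
    have hzz : z ≤ z₀ := by
      rw [hzi, hz₀]
      gcongr
    have hexp : Real.exp (-(z * (1 + z₀))) ≤ 1 - z := by
      refine le_trans ?_ (exp_neg_add_sq_le hzi0 (hzz.trans hz))
      gcongr
    calc _ ≤ binTerm N q t * Real.exp (-((1 + z₀) * (i * (w + 1) + (i : ℝ) ^ 2 / 2) / v)) *
          Real.exp (-(z * (1 + z₀))) := by
          rw [mul_assoc, ← Real.exp_add]
          refine mul_le_mul_of_nonneg_left (Real.exp_le_exp.2 ?_)
            (binTerm_nonneg hq0.le hq1.le N t)
          rw [hzi]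
          have : (1 + z₀) * (i * (w + 1) + (i : ℝ) ^ 2 / 2) / v + (w + i + 1) / v * (1 + z₀) ≤
              (1 + z₀) * (((i + 1 : ℕ) : ℝ) * (w + 1) + ((i + 1 : ℕ) : ℝ) ^ 2 / 2) / v := by
            rw [div_mul_eq_mul_div, ← add_div]
            gcongr
            push_cast
            nlinarith
          linarith
      _ ≤ binTerm N q (t + i) * (1 - z) :=
          mul_le_mul (ih hi) hexp (Real.exp_pos _).le (binTerm_nonneg hq0.le hq1.le N _)
      _ ≤ _ := step

lemma sum_binTerm (N : ℕ) (q : ℝ) : ∑ t ∈ Finset.range (N + 1), binTerm N q t = 1 := by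
  have h := congrArg (Polynomial.eval q) (bernsteinPolynomial.sum ℝ N)
  simpa [Polynomial.eval_finsetSum, bernsteinPolynomial, binTerm] using h

lemma sum_sq_mul_binTerm (N : ℕ) (q : ℝ) :
    ∑ t ∈ Finset.range (N + 1), (N * q - t) ^ 2 * binTerm N q t = N * (q * (1 - q)) := by
  have h := congrArg (Polynomial.eval q) (bernsteinPolynomial.variance ℝ N)
  simpa [Polynomial.eval_finsetSum, bernsteinPolynomial, binTerm, mul_assoc] using h

/-- Chebyshev with `w` at least two standard deviations. -/
lemma sum_binTerm_window (hq0 : 0 < q) (hq1 : q < 1) (hN : 0 < N) {w : ℝ} (hw : 0 ≤ w)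
    (hw2 : 4 * (N * (q * (1 - q))) ≤ w ^ 2) :
    3 / 4 ≤ ∑ t ∈ Finset.range (N + 1) with |(N : ℝ) * q - (t : ℕ)| ≤ w, binTerm N q t := by
  have hq' : 0 < 1 - q := sub_pos.2 hq1
  have hN' : (0 : ℝ) < N := by exact_mod_cast hN
  have hv : 0 < (N : ℝ) * (q * (1 - q)) := by positivity
  have hsum := Finset.sum_filter_add_sum_filter_not (Finset.range (N + 1))
    (fun t : ℕ => |(N : ℝ) * q - t| ≤ w) (binTerm N q)
  rw [sum_binTerm] at hsum
  have hoff : (∑ t ∈ Finset.range (N + 1) with ¬ |(N : ℝ) * q - (t : ℕ)| ≤ w, binTerm N q t) *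
      (4 * (N * (q * (1 - q)))) ≤ N * (q * (1 - q)) := by
    rw [← sum_sq_mul_binTerm N q, Finset.sum_mul]
    refine (Finset.sum_le_sum (g := fun t : ℕ => (N * q - t) ^ 2 * binTerm N q t)
      fun t ht => ?_).trans (Finset.sum_le_sum_of_subset_of_nonneg (Finset.filter_subset _ _)
        fun t _ _ => mul_nonneg (sq_nonneg _) (binTerm_nonneg hq0.le hq1.le N t))
    rw [mul_comm]
    refine mul_le_mul_of_nonneg_right ?_ (binTerm_nonneg hq0.le hq1.le N t)
    rw [sum_sq_mul_binTerm, ← sq_abs ((N : ℝ) * q - t)]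
    have := (Finset.mem_filter.1 ht).2
    rw [not_le] at this
    refine hw2.trans ?_
    gcongr
  nlinarith

lemma sum_binTerm_le_binTail (hq0 : 0 ≤ q) (hq1 : q ≤ 1) {T : ℕ} {S : Finset ℕ}
    (hS : ∀ t ∈ S, T ≤ t) : ∑ t ∈ S, binTerm N q t ≤ binTail N q T := by
  rw [binTail, Finset.sum_subset (Finset.subset_union_left (s₁ := Finset.Icc T N) (s₂ := S))]
  · exact Finset.sum_le_sum_of_subset_of_nonneg Finset.subset_union_right
      fun t _ _ => binTerm_nonneg hq0 hq1 N t
  · intro t ht hT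
    refine binTerm_eq_zero_of_lt ?_ q
    simp only [Finset.mem_union, Finset.mem_Icc] at ht hT
    rcases ht with ht | ht
    · exact absurd ht hT
    · have := hS t ht
      omega

lemma binTail_nonneg (hq0 : 0 ≤ q) (hq1 : q ≤ 1) (N T : ℕ) : 0 ≤ binTail N q T :=
  Finset.sum_nonneg fun t _ => binTerm_nonneg hq0 hq1 N t

/-- A moderate deviations lower bound for the binomial distribution. -/
lemma le_binTail (hq0 : 0 < q) (hq1 : q < 1) (hN : 0 < N) {w H : ℝ} (hw : 0 ≤ w)
    (hw2 : 4 * (N * (q * (1 - q))) ≤ w ^ 2)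
    (hz : (w + H + 1) / (N * (q * (1 - q))) ≤ 1 / 2) {T h : ℕ}
    (hT : T + w ≤ N * q + h) (hH : h ≤ H) :
    3 / 4 * Real.exp (-((1 + (w + H + 1) / (N * (q * (1 - q)))) *
      (H * (w + 1) + H ^ 2 / 2) / (N * (q * (1 - q))))) ≤ binTail N q T := by
  have hq' : 0 < 1 - q := sub_pos.2 hq1
  have hN' : (0 : ℝ) < N := by exact_mod_cast hN
  have hH0 : 0 ≤ H := (Nat.cast_nonneg h).trans hH
  calc _ ≤ (∑ t ∈ Finset.range (N + 1) with |(N : ℝ) * q - (t : ℕ)| ≤ w, binTerm N q t) *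
        Real.exp (-((1 + (w + H + 1) / (N * (q * (1 - q)))) *
          (h * (w + 1) + (h : ℝ) ^ 2 / 2) / (N * (q * (1 - q))))) := by
        refine mul_le_mul (sum_binTerm_window hq0 hq1 hN hw hw2) ?_ (Real.exp_pos _).le
          (Finset.sum_nonneg fun t _ => binTerm_nonneg hq0.le hq1.le N t)
        gcongr
    -- The whole central window is translated by `h`, which puts it at or above `T`.
    _ ≤ ∑ t ∈ Finset.range (N + 1) with |(N : ℝ) * q - (t : ℕ)| ≤ w, binTerm N q (t + h) := by
        rw [Finset.sum_mul]
        refine Finset.sum_le_sum fun t ht => binTerm_shift hq0 hq1 hN hw hz ?_ hH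
        have := (abs_le.1 (Finset.mem_filter.1 ht).2).1
        linarith
    _ = ∑ t ∈ (Finset.range (N + 1) |>.filter fun t : ℕ => |(N : ℝ) * q - t| ≤ w).map
          (addRightEmbedding h), binTerm N q t := by simp
    _ ≤ _ := by
        refine sum_binTerm_le_binTail hq0.le hq1.le fun t ht => ?_
        simp only [Finset.mem_map, addRightEmbedding_apply] at ht
        obtain ⟨s, hs, rfl⟩ := ht
        have := (abs_le.1 (Finset.mem_filter.1 hs).2).2
        have : (T : ℝ) ≤ (s + h : ℕ) := by push_cast; linarith
        exact_mod_cast this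

/-- Terms vary slowly here: each of the `J` terms after `t` is at least half of the term at `t`, so
that term is at most `2 / J` of the remaining tail. -/
lemma binTail_le_succ (hq0 : 0 < q) (hq1 : q < 1) (hN : 0 < N) {y : ℝ} (hy : 0 ≤ y) {t J : ℕ}
    (hJ : 0 < J) (ht : t + J ≤ N * q + y) (hz : J * ((y + 1) / (N * (q * (1 - q)))) ≤ 1 / 2) :
    binTail N q t ≤ (1 + 2 / J) * binTail N q (t + 1) := by
  have hq' : 0 < 1 - q := sub_pos.2 hq1
  have hN' : (0 : ℝ) < N := by exact_mod_cast hN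
  have hJ' : (1 : ℝ) ≤ J := by exact_mod_cast hJ
  have hF := binTail_nonneg hq0.le hq1.le N (t + 1)
  rcases lt_or_ge N t with h | h
  · have : binTail N q t = 0 := by simp [binTail, h]
    rw [this]
    positivity
  set z := (y + 1) / (N * (q * (1 - q))) with hzdef
  have hz0 : 0 ≤ z := by positivity
  have hz1 : z ≤ 1 := by nlinarith
  have hb : ∀ j : ℕ, j ≤ J → binTerm N q t * (1 - j * z) ≤ binTerm N q (t + j) := by
    intro j
    induction j with
    | zero => intro; simp
    | succ j ih =>
      intro hj
      have hj' : ((j : ℝ) + 1) ≤ J := by exact_mod_cast hj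
      calc binTerm N q t * (1 - ((j + 1 : ℕ) : ℝ) * z)
          ≤ binTerm N q t * (1 - j * z) * (1 - z) := by
            rw [mul_assoc]
            refine mul_le_mul_of_nonneg_left ?_ (binTerm_nonneg hq0.le hq1.le N t)
            push_cast
            nlinarith [mul_nonneg (Nat.cast_nonneg j : (0 : ℝ) ≤ j) (mul_nonneg hz0 hz0)]
        _ ≤ binTerm N q (t + j) * (1 - z) :=
            mul_le_mul_of_nonneg_right (ih (by omega)) (by linarith)
        _ ≤ _ := binTerm_mul_le_succ hq0 hq1 hN hy (by push_cast; linarith)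
  have hhalf : J * (binTerm N q t / 2) ≤ binTail N q (t + 1) := by
    calc J * (binTerm N q t / 2) = ∑ j ∈ Finset.range J, binTerm N q t / 2 := by simp
      _ ≤ ∑ j ∈ Finset.range J, binTerm N q (j + (t + 1)) := by
          refine Finset.sum_le_sum fun j hj => ?_
          have hj1 : j + 1 ≤ J := Finset.mem_range.1 hj
          have hj' : ((j : ℝ) + 1) ≤ J := by exact_mod_cast hj1
          have := hb (j + 1) hj1
          rw [show j + (t + 1) = t + (j + 1) by ring]
          refine le_trans ?_ this
          rw [div_eq_mul_inv]
          refine mul_le_mul_of_nonneg_left ?_ (binTerm_nonneg hq0.le hq1.le N t)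
          push_cast
          nlinarith
      _ = ∑ s ∈ (Finset.range J).map (addRightEmbedding (t + 1)), binTerm N q s := by simp
      _ ≤ _ := by
          refine sum_binTerm_le_binTail hq0.le hq1.le fun s hs => ?_
          simp only [Finset.mem_map, addRightEmbedding_apply] at hs
          obtain ⟨j, _, rfl⟩ := hs
          omega
  have hsplit : binTail N q t = binTerm N q t + binTail N q (t + 1) := by
    rw [binTail, binTail, ← Finset.insert_Icc_add_one_left_eq_Icc h, Finset.sum_insert (by simp)]
  have h2 : binTerm N q t ≤ 2 / J * binTail N q (t + 1) := by
    rw [div_mul_eq_mul_div, le_div_iff₀ (by linarith)]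
    linarith
  linarith

lemma binTail_sub_le (hq0 : 0 < q) (hq1 : q < 1) (hN : 0 < N) {y : ℝ} (hy : 0 ≤ y) {T J : ℕ}
    (hJ : 0 < J) (hT : T + J ≤ N * q + y) (hz : J * ((y + 1) / (N * (q * (1 - q)))) ≤ 1 / 2)
    (k : ℕ) : binTail N q (T - k) ≤ (1 + 2 / J) ^ k * binTail N q T := by
  induction k with
  | zero => simp
  | succ k ih =>
    have hF := binTail_nonneg hq0.le hq1.le N T
    rcases Nat.lt_or_ge k T with h | h
    · have e : T - k = T - (k + 1) + 1 := by omega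
      rw [e] at ih
      have hle : ((T - (k + 1) : ℕ) : ℝ) ≤ T := by exact_mod_cast Nat.sub_le _ _
      refine (binTail_le_succ hq0 hq1 hN hy hJ (by linarith) hz).trans ?_
      rw [pow_succ', mul_assoc]
      gcongr
    · rw [show T - (k + 1) = T - k by omega]
      refine ih.trans ?_
      gcongr
      · have : (0 : ℝ) ≤ 2 / J := by positivity
        linarith
      · omega
end binomial

/-! ### Binomial tails at deviations of order `√(n log n)`. -/

section asymptotics
open Filter

lemma tendsto_natCast_mul_log : Tendsto (fun n : ℕ => (n : ℝ) * Real.log n) atTop atTop :=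
  (tendsto_natCast_atTop_atTop).atTop_mul_atTop₀
    (Real.tendsto_log_atTop.comp tendsto_natCast_atTop_atTop)

lemma tendsto_sqrt_mul_log : Tendsto (fun n : ℕ => √((n : ℝ) * Real.log n)) atTop atTop :=
  Real.tendsto_sqrt_atTop.comp tendsto_natCast_mul_log

lemma tendsto_const_div_sqrt_mul_log (c : ℝ) :
    Tendsto (fun n : ℕ => c / √((n : ℝ) * Real.log n)) atTop (𝓝 0) :=
  tendsto_sqrt_mul_log.const_div_atTop c

lemma tendsto_sqrt_div_sqrt_mul_log :
    Tendsto (fun n : ℕ => √(n : ℝ) / √((n : ℝ) * Real.log n)) atTop (𝓝 0) := by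
  have h : Tendsto (fun n : ℕ => 1 / √(Real.log n)) atTop (𝓝 0) :=
    (Real.tendsto_sqrt_atTop.comp
      (Real.tendsto_log_atTop.comp tendsto_natCast_atTop_atTop)).const_div_atTop 1
  refine h.congr' ?_
  filter_upwards [eventually_gt_atTop 0] with n hn
  have : 0 < √(n : ℝ) := Real.sqrt_pos.2 (by exact_mod_cast hn)
  rw [Real.sqrt_mul (by positivity)]
  field_simp

lemma tendsto_natCast_div_sub (k : ℕ) {v : ℝ} (hv : v ≠ 0) :
    Tendsto (fun n : ℕ => (n : ℝ) / (((n - k : ℕ) : ℝ) * v)) atTop (𝓝 v⁻¹) := by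
  have h : Tendsto (fun n : ℕ => ((1 - (k : ℝ) / n) * v)⁻¹) atTop (𝓝 ((1 - 0) * v)⁻¹) :=
    (((tendsto_const_div_atTop_nhds_zero_nat (k : ℝ)).const_sub 1).mul_const v).inv₀
      (by simpa using hv)
  rw [sub_zero, one_mul] at h
  refine h.congr' ?_
  filter_upwards [eventually_gt_atTop k] with n hn
  have h0 : (n : ℝ) ≠ 0 := by
    have : 0 < n := by omega
    positivity
  have h1 : (n : ℝ) - k ≠ 0 := sub_ne_zero.2 (by exact_mod_cast hn.ne')
  rw [Nat.cast_sub hn.le]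
  field_simp

lemma sqrt_mul_log_div (n : ℕ) : √((n : ℝ) * Real.log n) / n = √(Real.log n / n) := by
  rcases n.eq_zero_or_pos with rfl | hn
  · simp
  have hn' : (0 : ℝ) < n := by exact_mod_cast hn
  rw [div_eq_iff hn'.ne', show (n : ℝ) * Real.log n = Real.log n / n * (n : ℝ) ^ 2 by field_simp,
    Real.sqrt_mul (div_nonneg (Real.log_natCast_nonneg n) hn'.le), Real.sqrt_sq hn'.le]

variable {q u : ℝ}

lemma tendsto_affine_div_sqrt_mul_log (a b c : ℝ) :
    Tendsto (fun n : ℕ => (a * √((n : ℝ) * Real.log n) + b * √(n : ℝ) + c) /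
      √((n : ℝ) * Real.log n)) atTop (𝓝 a) := by
  have h := ((tendsto_sqrt_div_sqrt_mul_log.const_mul b).const_add a).add
    (tendsto_const_div_sqrt_mul_log c)
  simp only [mul_zero, add_zero] at h
  refine h.congr' ?_
  filter_upwards [tendsto_sqrt_mul_log.eventually_gt_atTop 0] with n hn
  field_simp

lemma tendsto_affine_div_zero (a b c : ℝ) (k : ℕ) {v : ℝ} (hv : v ≠ 0) :
    Tendsto (fun n : ℕ => (a * √((n : ℝ) * Real.log n) + b * √(n : ℝ) + c) /
      (((n - k : ℕ) : ℝ) * v)) atTop (𝓝 0) := by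
  have h := ((tendsto_affine_div_sqrt_mul_log a b c).mul
    SimpleGraph.tendsto_sqrt_log_div).mul (tendsto_natCast_div_sub k hv)
  simp only [mul_zero, zero_mul] at h
  refine h.congr' ?_
  filter_upwards [tendsto_sqrt_mul_log.eventually_gt_atTop 0, eventually_gt_atTop 0] with n hn h0
  have h0' : (0 : ℝ) < n := by exact_mod_cast h0
  rw [← sqrt_mul_log_div]
  field_simp

/-- Apply `le_binTail` with window `√n`, which exceeds two standard deviations because `4 q (1 - q)
≤ 1`, yet is negligible against the shift of order `√(n log n)`. The exponent is then asymptotically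
`(q u)² / (2 q (1 - q))` times `log n`. -/
lemma eventually_le_binTail (hq0 : 0 < q) (hq1 : q < 1) (hu : 0 ≤ u) (k : ℕ) {η : ℝ}
    (hη : 0 < η) :
    ∀ᶠ n : ℕ in atTop, (n : ℝ) ^ (-(u ^ 2 / (2 * (q⁻¹ - 1)) + η)) ≤
      binTail (n - k) q ⌈q * (n + u * √(n * Real.log n))⌉₊ := by
  have hq' : 0 < 1 - q := sub_pos.2 hq1
  have hv : 0 < q * (1 - q) := by positivity
  -- The term `k + 2` absorbs the `k` missing trials and two roundings up.
  set H : ℕ → ℝ := fun n => q * u * √(n * Real.log n) + 1 * √(n : ℝ) + (k + 2) with hH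
  set Z : ℕ → ℝ := fun n => (√(n : ℝ) + H n + 1) / (((n - k : ℕ) : ℝ) * (q * (1 - q))) with hZ
  set E : ℕ → ℝ := fun n => (1 + Z n) * (H n * (√(n : ℝ) + 1) + H n ^ 2 / 2) /
    (((n - k : ℕ) : ℝ) * (q * (1 - q))) with hE
  have hZ0 : Tendsto Z atTop (𝓝 0) := by
    refine (tendsto_affine_div_zero (q * u) 2 (k + 3) k hv.ne').congr fun n => ?_
    simp only [hZ, hH]
    ring
  have hE0 : Tendsto (fun n => E n / Real.log n) atTop (𝓝 (u ^ 2 / (2 * (q⁻¹ - 1)))) := by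
    have ha := tendsto_affine_div_sqrt_mul_log (q * u) 1 (k + 2)
    have hb := tendsto_affine_div_sqrt_mul_log 0 1 1
    have h := ((hZ0.const_add 1).mul ((ha.mul hb).add ((ha.pow 2).div_const 2))).mul
      (tendsto_natCast_div_sub k hv.ne')
    have e : (1 + 0) * (q * u * 0 + (q * u) ^ 2 / 2) * (q * (1 - q))⁻¹ =
        u ^ 2 / (2 * (q⁻¹ - 1)) := by
      have : q⁻¹ - 1 = (1 - q) / q := by field_simp
      rw [this]
      field_simp
      ring
    rw [e] at h
    refine h.congr' ?_
    filter_upwards [eventually_gt_atTop k, eventually_gt_atTop 1] with n hnk hn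
    have hn0 : (0 : ℝ) < n := by positivity
    have hlog : 0 < Real.log n := Real.log_pos (by exact_mod_cast hn)
    have hs : 0 < √((n : ℝ) * Real.log n) := Real.sqrt_pos.2 (by positivity)
    have hs2 : √((n : ℝ) * Real.log n) ^ 2 = n * Real.log n := Real.sq_sqrt (by positivity)
    have hN : (0 : ℝ) < ((n - k : ℕ) : ℝ) := by
      have : 0 < n - k := by omega
      exact_mod_cast this
    have e1 : H n * (0 * √((n : ℝ) * Real.log n) + 1 * √(n : ℝ) + 1) / (n * Real.log n) =
      H n / √((n : ℝ) * Real.log n) *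
        ((0 * √((n : ℝ) * Real.log n) + 1 * √(n : ℝ) + 1) / √((n : ℝ) * Real.log n)) := by
      rw [div_mul_div_comm, ← sq (√((n : ℝ) * Real.log n)), hs2]
    have e2 : H n ^ 2 / (n * Real.log n) = (H n / √((n : ℝ) * Real.log n)) ^ 2 := by
      rw [div_pow, hs2]
    change (1 + Z n) * (H n / √((n : ℝ) * Real.log n) *
        ((0 * √((n : ℝ) * Real.log n) + 1 * √(n : ℝ) + 1) / √((n : ℝ) * Real.log n)) +
        (H n / √((n : ℝ) * Real.log n)) ^ 2 / 2) * _ = _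
    rw [← e1, ← e2, hE]
    field_simp
    ring
  have hlogtop : Tendsto (fun n : ℕ => Real.log n) atTop atTop :=
    Real.tendsto_log_atTop.comp tendsto_natCast_atTop_atTop
  filter_upwards [eventually_gt_atTop k, eventually_gt_atTop 1,
    hZ0.eventually_lt_const (show (0 : ℝ) < 1 / 2 by norm_num),
    hE0.eventually_lt_const (show _ < u ^ 2 / (2 * (q⁻¹ - 1)) + η / 2 by linarith),
    hlogtop.eventually_ge_atTop (-Real.log (3 / 4) / (η / 2))] with n hnk hn hZn hEn hln
  have hn0 : (0 : ℝ) < n := by positivity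
  have hlog : 0 < Real.log n := Real.log_pos (by exact_mod_cast hn)
  rw [div_lt_iff₀ hlog] at hEn
  rw [div_le_iff₀ (by positivity)] at hln
  have hNn : ((n - k : ℕ) : ℝ) = n - k := Nat.cast_sub hnk.le
  set T := ⌈q * (n + u * √(n * Real.log n))⌉₊ with hT
  have hTlt : (T : ℝ) < q * (n + u * √(n * Real.log n)) + 1 := Nat.ceil_lt_add_one (by positivity)
  have hTge : q * (n + u * √(n * Real.log n)) ≤ T := Nat.le_ceil _
  have hk0 : (0 : ℝ) ≤ k := Nat.cast_nonneg k
  have hw0 : 0 ≤ √(n : ℝ) := Real.sqrt_nonneg _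
  have hus : 0 ≤ u * √(n * Real.log n) := by positivity
  have hpos : 0 ≤ T + √(n : ℝ) - ((n - k : ℕ) : ℝ) * q := by
    rw [hNn]
    nlinarith
  have main := le_binTail (N := n - k) hq0 hq1 (by omega) (w := √(n : ℝ)) (H := H n) hw0
    (by
      rw [Real.sq_sqrt hn0.le, hNn]
      nlinarith [sq_nonneg (2 * q - 1)]) hZn.le
    (T := T) (h := ⌈T + √(n : ℝ) - ((n - k : ℕ) : ℝ) * q⌉₊)
    (by linarith [Nat.le_ceil (T + √(n : ℝ) - ((n - k : ℕ) : ℝ) * q)])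
    (by
      have := Nat.ceil_lt_add_one hpos
      rw [hNn] at this ⊢
      simp only [hH]
      nlinarith)
  refine le_trans ?_ main
  change _ ≤ 3 / 4 * Real.exp (-E n)
  rw [Real.rpow_def_of_pos hn0, ← Real.exp_log (show (0 : ℝ) < 3 / 4 by norm_num), ← Real.exp_add,
    Real.exp_le_exp]
  linarith

/-- Fix `J` so large that `j` unit steps, each costing `1 + 2 / J`, stay below `1 + η`; this makes
the lowered thresholds for disjoint pairs harmless. -/
lemma eventually_binTail_sub_le (hq0 : 0 < q) (hq1 : q < 1) (hu : 0 ≤ u) (k j : ℕ) {η : ℝ}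
    (hη : 0 < η) :
    ∀ᶠ n : ℕ in atTop, binTail (n - k) q (⌈q * (n + u * √(n * Real.log n))⌉₊ - j) ≤
      (1 + η) * binTail (n - k) q ⌈q * (n + u * √(n * Real.log n))⌉₊ := by
  have hq' : 0 < 1 - q := sub_pos.2 hq1
  have hv : 0 < q * (1 - q) := by positivity
  obtain ⟨J, hJ0, hJ⟩ : ∃ J : ℕ, 0 < J ∧ (1 + 2 / (J : ℝ)) ^ j < 1 + η := by
    have h : Tendsto (fun J : ℕ => (1 + 2 / (J : ℝ)) ^ j) atTop (𝓝 ((1 + 0) ^ j)) :=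
      ((tendsto_const_div_atTop_nhds_zero_nat 2).const_add 1).pow j
    rw [add_zero, one_pow] at h
    exact ((eventually_gt_atTop 0).and (h.eventually_lt_const (by linarith))).exists
  have hz := (tendsto_affine_div_zero (q * u) 0 (J + k + 2) k hv.ne').const_mul (J : ℝ)
  rw [mul_zero] at hz
  filter_upwards [eventually_gt_atTop k, hz.eventually_lt_const (show (0 : ℝ) < 1 / 2 by norm_num)]
    with n hnk hzn
  have hlog : 0 ≤ Real.log n := Real.log_natCast_nonneg n
  have hNn : ((n - k : ℕ) : ℝ) = n - k := Nat.cast_sub hnk.le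
  set T := ⌈q * (n + u * √(n * Real.log n))⌉₊ with hT
  have hTlt : (T : ℝ) < q * (n + u * √(n * Real.log n)) + 1 := Nat.ceil_lt_add_one (by positivity)
  have hk0 : (0 : ℝ) ≤ k := Nat.cast_nonneg k
  refine (binTail_sub_le (N := n - k) hq0 hq1 (by omega)
    (y := q * u * √(n * Real.log n) + (J + k + 1)) (by positivity) (T := T) hJ0 ?_ ?_ j).trans ?_
  · rw [hNn]
    nlinarith
  · refine le_trans (le_of_eq ?_) hzn.le
    ring
  · gcongr
    exact binTail_nonneg hq0.le hq1.le _ _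
end asymptotics

/-! ### Comparison of the extremal levels and tail bounds at those levels. -/

namespace SimpleGraph
open Filter
variable {p : unitInterval}

lemma relVar_zero (p : unitInterval) : relVar p 0 = 0 := by simp [relVar]

lemma relVar_lt (hp0 : 0 < p) (hp1 : p < 1) {s l : ℕ} (hsl : s < l) :
    relVar p s < relVar p l := by
  have h0 : (0 : ℝ) < p := hp0
  have h1 : (p : ℝ) < 1 := hp1
  unfold relVar
  gcongr 1
  exact inv_strictAnti₀ (by positivity) (pow_lt_pow_right_of_lt_one₀ h0 h1 hsl)

lemma relVar_pos (hp0 : 0 < p) (hp1 : p < 1) {s : ℕ} (hs : 0 < s) : 0 < relVar p s := by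
  rw [← relVar_zero p]
  exact relVar_lt hp0 hp1 hs

lemma relVar_nonneg (hp0 : 0 < p) (hp1 : p < 1) (s : ℕ) : 0 ≤ relVar p s := by
  rcases s.eq_zero_or_pos with rfl | hs
  · rw [relVar_zero]
  · exact (relVar_pos hp0 hp1 hs).le

/-- Strict Bernoulli inequality applied to `1 + relVar p l = (1 + relVar p s) ^ (l / s)`. -/
lemma mul_relVar_lt (hp0 : 0 < p) (hp1 : p < 1) {s l : ℕ} (hs : 0 < s) (hsl : s < l) :
    l * relVar p s < s * relVar p l := by
  have h0 : (0 : ℝ) < p := hp0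
  have hs' : (0 : ℝ) < s := by exact_mod_cast hs
  have hsl' : (s : ℝ) < l := by exact_mod_cast hsl
  have hpos := relVar_pos hp0 hp1 hs
  have h := one_add_mul_self_lt_rpow_one_add (s := relVar p s) (by linarith) hpos.ne'
    (p := (l : ℝ) / s) ((one_lt_div hs').2 hsl')
  have e : (1 + relVar p s) ^ ((l : ℝ) / s) = 1 + relVar p l := by
    have e1 : 1 + relVar p s = ((p : ℝ)⁻¹) ^ (s : ℝ) := by
      rw [relVar, Real.rpow_natCast, inv_pow]; ring
    rw [e1, ← Real.rpow_mul (by positivity), mul_div_cancel₀ _ hs'.ne', Real.rpow_natCast, relVar,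
      inv_pow]
    ring
  rw [e] at h
  have h2 : (l : ℝ) / s * relVar p s < relVar p l := by linarith
  rw [div_mul_eq_mul_div, div_lt_iff₀ hs'] at h2
  linarith

/-- `(1 + ε)` times the normalised typical size of the largest deviation among `k`-sets. -/
noncomputable def level (p : unitInterval) (k : ℕ) (ε : ℝ) : ℝ := (1 + ε) * √(2 * k * relVar p k)

lemma level_sq (hp0 : 0 < p) (hp1 : p < 1) (k : ℕ) (ε : ℝ) :
    level p k ε ^ 2 = (1 + ε) ^ 2 * (2 * k * relVar p k) := by
  have := relVar_nonneg hp0 hp1 k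
  rw [level, mul_pow, Real.sq_sqrt (by positivity)]

lemma level_nonneg {k : ℕ} {ε : ℝ} (hε : -1 ≤ ε) : 0 ≤ level p k ε :=
  mul_nonneg (by linarith) (Real.sqrt_nonneg _)

lemma level_sq_div (hp0 : 0 < p) (hp1 : p < 1) {k : ℕ} (hk : 0 < k) (ε : ℝ) :
    level p k ε ^ 2 / (2 * relVar p k) = k * (1 + ε) ^ 2 := by
  have := relVar_pos hp0 hp1 hk
  rw [level_sq hp0 hp1]
  field_simp

lemma level_zero_lt (hp0 : 0 < p) (hp1 : p < 1) {s l : ℕ} (hs : 0 < s) (hsl : s < l) :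
    level p s 0 < level p l 0 := by
  have hs' : (0 : ℝ) < s := by exact_mod_cast hs
  have hsl' : (s : ℝ) < l := by exact_mod_cast hsl
  have h1 := relVar_pos hp0 hp1 hs
  have h2 := relVar_lt hp0 hp1 hsl
  simp only [level, add_zero, one_mul]
  apply Real.sqrt_lt_sqrt (by positivity)
  gcongr

/-- After expansion this is AM-GM for `s * relVar p l` and `l * relVar p s`, strict because
`mul_relVar_lt` makes them different. It says that extending an extremal `s`-set to an extremal
`l`-set costs more than the `n ^ (l - s)` available extensions. -/
lemma lt_sq_level_sub_div (hp0 : 0 < p) (hp1 : p < 1) {s l : ℕ} (hs : 0 < s) (hsl : s < l) :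
    (l : ℝ) - s < (level p l 0 - level p s 0) ^ 2 / (2 * (relVar p l - relVar p s)) := by
  have hs' : (0 : ℝ) < s := by exact_mod_cast hs
  have hsl' : (s : ℝ) < l := by exact_mod_cast hsl
  have h1 := relVar_pos hp0 hp1 hs
  have h2 := relVar_lt hp0 hp1 hsl
  have h3 := mul_relVar_lt hp0 hp1 hs hsl
  rw [lt_div_iff₀ (by linarith), sub_sq, level_sq hp0 hp1, level_sq hp0 hp1]
  have h4 : level p l 0 * level p s 0 < s * relVar p l + l * relVar p s := by
    refine lt_of_pow_lt_pow_left₀ 2 (by nlinarith) ?_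
    rw [mul_pow, level_sq hp0 hp1, level_sq hp0 hp1]
    nlinarith [sq_pos_of_pos (sub_pos.2 h3)]
  nlinarith

/-- The inequalities are strict at `ε = 0`, continuous in `ε`, and finite in number. -/
lemma exists_level_margin (hp0 : 0 < p) (hp1 : p < 1) (K : ℕ) :
    ∃ ε : ℝ, 0 < ε ∧ ε < 1 ∧ ∀ k ≤ K, ∀ l ≤ K, ∀ s, 0 < s → s < l →
      level p s ε ≤ level p l (-ε) ∧
      (k : ℝ) + l - s < k * (1 - ε) ^ 2 +
        (level p l (-ε) - level p s ε) ^ 2 / (2 * (relVar p l - relVar p s)) := by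
  have hcont : ∀ k, Continuous fun ε => level p k ε := by
    intro k; unfold level; fun_prop
  have h : ∀ k ≤ K, ∀ l ≤ K, ∀ s < l, ∀ᶠ ε in 𝓝 (0 : ℝ), 0 < s →
      level p s ε ≤ level p l (-ε) ∧
      (k : ℝ) + l - s < k * (1 - ε) ^ 2 +
        (level p l (-ε) - level p s ε) ^ 2 / (2 * (relVar p l - relVar p s)) := by
    intro k _ l _ s hsl
    rcases s.eq_zero_or_pos with rfl | hs
    · simp
    have hs1 := (hcont s).tendsto 0
    have hl1 : Tendsto (fun ε => level p l (-ε)) (𝓝 0) (𝓝 (level p l 0)) := by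
      have : Continuous fun ε => level p l (-ε) := (hcont l).comp continuous_neg
      simpa using this.tendsto 0
    have h1 := hs1.eventually_lt hl1 (level_zero_lt hp0 hp1 hs hsl)
    have h2 : Tendsto (fun ε : ℝ => k * (1 - ε) ^ 2 +
        (level p l (-ε) - level p s ε) ^ 2 / (2 * (relVar p l - relVar p s))) (𝓝 0)
        (𝓝 (k * (1 - 0) ^ 2 +
        (level p l 0 - level p s 0) ^ 2 / (2 * (relVar p l - relVar p s)))) :=
      (((tendsto_id.const_sub 1).pow 2).const_mul _).add (((hl1.sub hs1).pow 2).div_const _)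
    have h3 := h2.eventually_const_lt (u := (k : ℝ) + l - s)
      (by linarith [lt_sq_level_sub_div hp0 hp1 hs hsl])
    filter_upwards [h1, h3] with ε h1 h3 _ using ⟨h1.le, h3⟩
  have h' : ∀ᶠ ε in 𝓝 (0 : ℝ), ∀ k ≤ K, ∀ l ≤ K, ∀ s < l, 0 < s →
      level p s ε ≤ level p l (-ε) ∧
      (k : ℝ) + l - s < k * (1 - ε) ^ 2 +
        (level p l (-ε) - level p s ε) ^ 2 / (2 * (relVar p l - relVar p s)) := by
    have e := fun k hk l hl => (eventually_all_finite (Set.finite_Iio l)).2 (h k hk l hl)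
    have e := fun k hk => (eventually_all_finite (Set.finite_Iic K)).2 (e k hk)
    exact (eventually_all_finite (Set.finite_Iic K)).2 e
  have hpos : ∀ᶠ ε in 𝓝[>] (0 : ℝ), 0 < ε := eventually_mem_nhdsWithin
  obtain ⟨ε, h0, h1, h2⟩ := (hpos.and ((eventually_nhdsWithin_of_eventually_nhds
    ((eventually_lt_nhds one_pos).and h')))).exists
  exact ⟨ε, h0, h1, fun k hk l hl s hs hsl => h2 k hk l hl s hsl hs⟩

/-- The scale `√(n log n)` of the largest deviations of normalised common degrees. -/
noncomputable def devScale (n : ℕ) : ℝ := √(n * Real.log n)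

lemma eventually_dev_ge_le (hp0 : 0 < p) (hp1 : p < 1) {k : ℕ} (hk : 0 < k) {x : ℝ} (hx : 0 ≤ x)
    {η : ℝ} (hη : 0 < η) :
    ∀ᶠ n : ℕ in atTop, ∀ U : Finset (Fin n), U.card = k →
      (binomialRandom (Fin n) p).real {G | x * devScale n ≤ normDev p G U} ≤
        (n : ℝ) ^ (-(x ^ 2 / (2 * relVar p k) - η)) := by
  have hf := relVar_pos hp0 hp1 hk
  -- The optimal tilt: `θ = Q`, so `θ - Q / 2` is the Gaussian rate.
  have h := eventually_linear_ge_le hp0 (fun _ : Unit => x / relVar p k) k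
    (Q := x ^ 2 / relVar p k) (by positivity) (x ^ 2 / relVar p k) hη
  filter_upwards [h] with n h U hU
  have h1 := h (fun _ => U) (fun _ => hU.le) (by
    simp only [Finset.univ_unique, Finset.sum_const, Finset.card_singleton, one_smul,
      Finset.inter_self, hU]
    refine le_of_eq ?_
    field_simp)
  refine (measureReal_mono fun G hG => ?_).trans (h1.trans_eq ?_)
  · simp only [Set.mem_ofPred_eq, Finset.univ_unique, Finset.sum_const, Finset.card_singleton,
      one_smul] at hG ⊢
    have := mul_le_mul_of_nonneg_left hG (show 0 ≤ x / relVar p k by positivity)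
    refine le_trans (le_of_eq ?_) this
    rw [devScale]
    ring
  · congr 1
    field_simp
    ring

/-- Given `U` at level `u`, the Gaussian mean of `S` is `u * relVar p s / relVar p k`; exceeding it
costs an extra factor. The denominator uses `relVar p s` rather than the smaller conditional
variance, which suffices as only a positive gain is needed. -/
lemma eventually_dev_ge_and_subset_le (hp0 : 0 < p) (hp1 : p < 1) {k s : ℕ} (hs : 0 < s)
    (hk : s < k) {u t : ℝ} (hu : 0 ≤ u) (ht : u * relVar p s / relVar p k ≤ t)
    {η : ℝ} (hη : 0 < η) :
    ∀ᶠ n : ℕ in atTop, ∀ U S : Finset (Fin n), U.card = k → S ⊆ U → S.card = s →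
      (binomialRandom (Fin n) p).real
        {G | u * devScale n ≤ normDev p G U ∧ t * devScale n ≤ normDev p G S} ≤
        (n : ℝ) ^ (-(u ^ 2 / (2 * relVar p k) +
          (t - u * relVar p s / relVar p k) ^ 2 / (2 * relVar p s) - η)) := by
  have hf := relVar_pos hp0 hp1 (hs.trans hk)
  have hg := relVar_pos hp0 hp1 hs
  set β := u / relVar p k with hβ
  set α := (t - u * relVar p s / relVar p k) / relVar p s with hα
  have hβ0 : 0 ≤ β := by positivity
  have hα0 : 0 ≤ α := div_nonneg (by linarith) hg.le
  have hQ : 0 ≤ β ^ 2 * relVar p k + 2 * α * β * relVar p s + α ^ 2 * relVar p s := by positivity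
  have h := eventually_linear_ge_le hp0 ![β, α] k hQ (β * u + α * t) hη
  filter_upwards [h] with n h U S hU hSU hS
  have h1 := h ![U, S] (by
    intro i
    fin_cases i
    · exact hU.le
    · exact (hS.trans_lt hk).le) (by
    simp only [Fin.sum_univ_two, Matrix.cons_val_zero, Matrix.cons_val_one, Finset.inter_self,
      Finset.inter_eq_right.2 hSU, Finset.inter_eq_left.2 hSU, hU, hS]
    refine le_of_eq ?_
    ring)
  refine (measureReal_mono fun G hG => ?_).trans (h1.trans_eq ?_)
  · simp only [Set.mem_ofPred_eq, Fin.sum_univ_two, Matrix.cons_val_zero,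
      Matrix.cons_val_one] at hG ⊢
    have e1 := mul_le_mul_of_nonneg_left hG.1 hβ0
    have e2 := mul_le_mul_of_nonneg_left hG.2 hα0
    rw [devScale] at e1 e2
    linarith
  · congr 1
    rw [hβ, hα]
    field_simp
    ring

/-- The increment from `U ∩ W` to `W` is uncorrelated with `U`: both `W` and `U ∩ W` have covariance
`relVar p s` with it. So the weights `β, γ, -γ` have no cross terms and the two costs add. -/
lemma eventually_dev_ge_and_dev_ge_le (hp0 : 0 < p) (hp1 : p < 1) {k l s : ℕ} (hs : 0 < s)
    (hk : s ≤ k) (hl : s < l) {u w t : ℝ} (hu : 0 ≤ u) (ht : t ≤ w) {η : ℝ} (hη : 0 < η) :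
    ∀ᶠ n : ℕ in atTop, ∀ U W : Finset (Fin n), U.card = k → W.card = l → (U ∩ W).card = s →
      (binomialRandom (Fin n) p).real
        {G | u * devScale n ≤ normDev p G U ∧ w * devScale n ≤ normDev p G W ∧
          normDev p G (U ∩ W) ≤ t * devScale n} ≤
        (n : ℝ) ^ (-(u ^ 2 / (2 * relVar p k) +
          (w - t) ^ 2 / (2 * (relVar p l - relVar p s)) - η)) := by
  have hf := relVar_pos hp0 hp1 (hs.trans_le hk)
  have hg := sub_pos.2 (relVar_lt hp0 hp1 hl)
  set β := u / relVar p k with hβ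
  set γ := (w - t) / (relVar p l - relVar p s) with hγ
  have hβ0 : 0 ≤ β := by positivity
  have hγ0 : 0 ≤ γ := div_nonneg (by linarith) hg.le
  have hQ : 0 ≤ β ^ 2 * relVar p k + γ ^ 2 * (relVar p l - relVar p s) := by positivity
  have h := eventually_linear_ge_le hp0 ![β, γ, -γ] (k + l) hQ (β * u + γ * (w - t)) hη
  filter_upwards [h] with n h U W hU hW hUW
  have i1 : U ∩ (U ∩ W) = U ∩ W := by simp
  have i2 : W ∩ (U ∩ W) = U ∩ W := by simp
  have i3 : (U ∩ W) ∩ U = U ∩ W := by rw [Finset.inter_comm, i1]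
  have i4 : (U ∩ W) ∩ W = U ∩ W := by rw [Finset.inter_comm, i2]
  have h1 := h ![U, W, U ∩ W] (by
    intro i
    fin_cases i
    · simp [hU]
    · simp [hW]
    · simp [hUW]; omega) (by
    simp only [Fin.sum_univ_three, Matrix.cons_val_zero, Matrix.cons_val_one, Matrix.cons_val,
      Finset.inter_self, i1, i2, i3, i4, Finset.inter_comm W U, hU, hW, hUW]
    refine le_of_eq ?_
    ring)
  refine (measureReal_mono fun G hG => ?_).trans (h1.trans_eq ?_)
  · simp only [Set.mem_ofPred_eq, Fin.sum_univ_three, Matrix.cons_val_zero,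
      Matrix.cons_val_one, Matrix.cons_val] at hG ⊢
    have e1 := mul_le_mul_of_nonneg_left hG.1 hβ0
    have e2 := mul_le_mul_of_nonneg_left hG.2.1 hγ0
    have e3 := mul_le_mul_of_nonneg_left hG.2.2 hγ0
    rw [devScale] at e1 e2 e3
    linarith
  · congr 1
    rw [hβ, hγ]
    field_simp
    ring
end SimpleGraph

/-! ### Union bounds and probabilities of near-maximal degree. -/

namespace SimpleGraph
open Filter
variable {p : unitInterval}

lemma tendsto_sum_zero_of_le_rpow {α : ℕ → Type*} (F : (n : ℕ) → Finset (α n))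
    (g : (n : ℕ) → α n → ℝ) {a C : ℝ} {b : ℕ} (_hC : 0 ≤ C) (hg : ∀ n, ∀ x ∈ F n, 0 ≤ g n x)
    (hga : ∀ᶠ n : ℕ in atTop, ∀ x ∈ F n, g n x ≤ (n : ℝ) ^ (-a))
    (hF : ∀ n, ((F n).card : ℝ) ≤ C * (n : ℝ) ^ b) (hab : (b : ℝ) < a) :
    Tendsto (fun n => ∑ x ∈ F n, g n x) atTop (𝓝 0) := by
  have hlim : Tendsto (fun n : ℕ => C * (n : ℝ) ^ (-(a - b))) atTop (𝓝 0) := by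
    simpa using ((tendsto_rpow_neg_atTop (sub_pos.2 hab)).comp
      tendsto_natCast_atTop_atTop).const_mul C
  refine squeeze_zero' (Eventually.of_forall fun n => Finset.sum_nonneg (hg n)) ?_ hlim
  filter_upwards [hga, eventually_gt_atTop 0] with n h hn
  have hn0 : (0 : ℝ) < n := by exact_mod_cast hn
  calc ∑ x ∈ F n, g n x ≤ (F n).card * (n : ℝ) ^ (-a) := by
        simpa using Finset.sum_le_card_nsmul _ _ _ h
    _ ≤ C * (n : ℝ) ^ b * (n : ℝ) ^ (-a) := by
        gcongr
        exact hF n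
    _ = _ := by
        rw [mul_assoc, ← Real.rpow_natCast, ← Real.rpow_add hn0]
        congr 2
        ring

lemma tendsto_sum_dev_ge (hp0 : 0 < p) (hp1 : p < 1) {s : ℕ} (hs : 0 < s) {ε : ℝ} (hε : 0 < ε) :
    Tendsto (fun n : ℕ => ∑ S ∈ Finset.powersetCard s (Finset.univ : Finset (Fin n)),
      (binomialRandom (Fin n) p).real {G | level p s ε * devScale n ≤ normDev p G S})
      atTop (𝓝 0) := by
  have hs' : (0 : ℝ) < s := by exact_mod_cast hs
  have hη : 0 < s * ε := by positivity
  have h := eventually_dev_ge_le hp0 hp1 hs (x := level p s ε) (level_nonneg (by linarith)) hη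
  refine tendsto_sum_zero_of_le_rpow _ _ (a := s * (1 + ε) ^ 2 - s * ε) (C := 1) (b := s)
    zero_le_one (fun n _ _ => measureReal_nonneg) ?_ (fun n => ?_) (by nlinarith [sq_nonneg ε])
  · filter_upwards [h] with n h S hS
    have := h S (Finset.mem_powersetCard.1 hS).2
    rwa [level_sq_div hp0 hp1 hs] at this
  · rw [Finset.card_powersetCard, Finset.card_univ, Fintype.card_fin, one_mul]
    exact_mod_cast Nat.choose_le_pow n s

/-- The pairs of a `k`-set and an `l`-set that intersect in `s` elements. -/
def intersectingPairs (V : Type*) [Fintype V] [DecidableEq V] (k l s : ℕ) :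
    Finset (Finset V × Finset V) :=
  (Finset.powersetCard k Finset.univ ×ˢ Finset.powersetCard l Finset.univ).filter
    fun x => (x.1 ∩ x.2).card = s

lemma mem_intersectingPairs {V : Type*} [Fintype V] [DecidableEq V] {k l s : ℕ}
    {x : Finset V × Finset V} :
    x ∈ intersectingPairs V k l s ↔ x.1.card = k ∧ x.2.card = l ∧ (x.1 ∩ x.2).card = s := by
  simp [intersectingPairs, Finset.mem_powersetCard, and_assoc]

/-- A pair is given by its union, of size `k + l - s`, and two subsets of it. -/
lemma card_intersectingPairs_le (n k l s : ℕ) :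
    ((intersectingPairs (Fin n) k l s).card : ℝ) ≤ 4 ^ (k + l - s) * (n : ℝ) ^ (k + l - s) := by
  have hsub : intersectingPairs (Fin n) k l s ⊆
      (Finset.powersetCard (k + l - s) Finset.univ).biUnion
        fun M => M.powerset ×ˢ M.powerset := by
    intro x hx
    rw [mem_intersectingPairs] at hx
    have := Finset.card_union_add_card_inter x.1 x.2
    simp only [Finset.mem_biUnion, Finset.mem_powersetCard, Finset.mem_product,
      Finset.mem_powerset]
    exact ⟨x.1 ∪ x.2, ⟨Finset.subset_univ _, by omega⟩, Finset.subset_union_left,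
      Finset.subset_union_right⟩
  have h1 := (Finset.card_le_card hsub).trans (Finset.card_biUnion_le_card_mul _ _ (4 ^ (k + l - s))
    fun M hM => by
      rw [Finset.card_product, Finset.card_powerset, (Finset.mem_powersetCard.1 hM).2, ← mul_pow]
      norm_num)
  rw [Finset.card_powersetCard, Finset.card_univ, Fintype.card_fin] at h1
  have h2 := h1.trans (Nat.mul_le_mul_right _ (Nat.choose_le_pow n (k + l - s)))
  rw [mul_comm] at h2
  exact_mod_cast h2

/-- Both sets have nearly maximal common degree, and their intersection is not exceptional. -/
def badPair (p : unitInterval) (ε : ℝ) {n : ℕ} (U W : Finset (Fin n)) :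
    Set (SimpleGraph (Fin n)) :=
  {G | level p U.card (-ε) * devScale n ≤ normDev p G U ∧
    level p W.card (-ε) * devScale n ≤ normDev p G W ∧
    normDev p G (U ∩ W) ≤ level p (U ∩ W).card ε * devScale n}

lemma tendsto_sum_badPair (hp0 : 0 < p) (hp1 : p < 1) {k l s : ℕ} (hs : 0 < s) (hk : s ≤ k)
    (hl : s < l) {ε : ℝ} (hε : ε ≤ 1) (hlevel : level p s ε ≤ level p l (-ε))
    (hmargin : (k : ℝ) + l - s < k * (1 - ε) ^ 2 +
        (level p l (-ε) - level p s ε) ^ 2 / (2 * (relVar p l - relVar p s))) :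
    Tendsto (fun n : ℕ => ∑ x ∈ intersectingPairs (Fin n) k l s,
      (binomialRandom (Fin n) p).real (badPair p ε x.1 x.2)) atTop (𝓝 0) := by
  set a := k * (1 - ε) ^ 2 +
    (level p l (-ε) - level p s ε) ^ 2 / (2 * (relVar p l - relVar p s)) with ha
  -- Half of the margin pays for the Chernoff error; the other half makes the sum vanish.
  have hη : 0 < (a - ((k : ℝ) + l - s)) / 2 := by linarith
  have h := eventually_dev_ge_and_dev_ge_le hp0 hp1 hs hk hl (u := level p k (-ε))
    (level_nonneg (by linarith)) hlevel hη
  refine tendsto_sum_zero_of_le_rpow _ _ (a := a - (a - ((k : ℝ) + l - s)) / 2)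
    (C := 4 ^ (k + l - s)) (b := k + l - s) (by positivity)
    (fun n _ _ => measureReal_nonneg) ?_ (fun n => card_intersectingPairs_le n k l s) ?_
  · filter_upwards [h] with n h x hx
    obtain ⟨h1, h2, h3⟩ := mem_intersectingPairs.1 hx
    have := h x.1 x.2 h1 h2 h3
    rw [level_sq_div hp0 hp1 (hs.trans_le hk), ← sub_eq_add_neg, ← ha] at this
    simpa only [badPair, h1, h2, h3] using this
  · rw [Nat.cast_sub (by omega), Nat.cast_add]
    linarith

/-- The integer threshold for the common degree of a `k`-set to have deviation at least
`level p k (-ε) * devScale n`. -/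
noncomputable def degThreshold (p : unitInterval) (k : ℕ) (ε : ℝ) (n : ℕ) : ℕ :=
  ⌈(p : ℝ) ^ k * (n + level p k (-ε) * √(n * Real.log n))⌉₊

/-- The probability that a `k`-set has nearly maximal common degree. -/
noncomputable def hitProb (p : unitInterval) (k : ℕ) (ε : ℝ) (n : ℕ) : ℝ :=
  binTail (n - k) ((p : ℝ) ^ k) (degThreshold p k ε n)

lemma level_le_normDev_iff (hp0 : 0 < p) {n : ℕ} (G : SimpleGraph (Fin n)) (U : Finset (Fin n))
    (ε : ℝ) : level p U.card (-ε) * devScale n ≤ normDev p G U ↔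
      degThreshold p U.card ε n ≤ G.commonDegree U := by
  have h0 : (0 : ℝ) < p := hp0
  rw [degThreshold, Nat.ceil_le, normDev, Fintype.card_fin, devScale, le_sub_iff_add_le,
    le_div_iff₀ (by positivity), add_comm, mul_comm]

lemma binomialRandom_real_level_le (hp0 : 0 < p) {n k : ℕ} {U : Finset (Fin n)}
    (hU : U.card = k) (ε : ℝ) :
    (binomialRandom (Fin n) p).real {G | level p k (-ε) * devScale n ≤ normDev p G U} =
      hitProb p k ε n := by
  subst hU
  simp_rw [level_le_normDev_iff hp0]
  rw [binomialRandom_real_commonDegree_ge, Fintype.card_fin, hitProb]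

lemma hitProb_nonneg (n k : ℕ) (ε : ℝ) : 0 ≤ hitProb p k ε n :=
  binTail_nonneg (pow_nonneg p.2.1 _) (pow_le_one₀ p.2.1 p.2.2) _ _

lemma eventually_le_hitProb (hp0 : 0 < p) (hp1 : p < 1) {k : ℕ} (hk : 0 < k) {ε : ℝ}
    (hε : ε ≤ 1) {η : ℝ} (hη : 0 < η) :
    ∀ᶠ n : ℕ in atTop, (n : ℝ) ^ (-(k * (1 - ε) ^ 2 + η)) ≤ hitProb p k ε n := by
  have h0 : (0 : ℝ) < p := hp0
  have h := eventually_le_binTail (q := (p : ℝ) ^ k) (by positivity)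
    (pow_lt_one₀ h0.le hp1 hk.ne') (u := level p k (-ε)) (level_nonneg (by linarith)) k hη
  have e := level_sq_div hp0 hp1 hk (-ε)
  rw [← sub_eq_add_neg, relVar] at e
  rwa [e] at h

lemma eventually_disjoint_le (hp0 : 0 < p) (hp1 : p < 1) {k : ℕ} (hk : 0 < k) {ε : ℝ}
    (hε : ε ≤ 1) {η : ℝ} (hη : 0 < η) :
    ∀ᶠ n : ℕ in atTop, ∀ U W : Finset (Fin n), U.card = k → W.card = k → Disjoint U W →
      (binomialRandom (Fin n) p).real {G | level p k (-ε) * devScale n ≤ normDev p G U ∧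
        level p k (-ε) * devScale n ≤ normDev p G W} ≤ ((1 + η) * hitProb p k ε n) ^ 2 := by
  have h0 : (0 : ℝ) < p := hp0
  have h := eventually_binTail_sub_le (q := (p : ℝ) ^ k) (by positivity)
    (pow_lt_one₀ h0.le hp1 hk.ne') (u := level p k (-ε)) (level_nonneg (by linarith)) k k hη
  filter_upwards [h] with n h U W hU hW hUW
  have e1 := fun G => level_le_normDev_iff hp0 G U ε
  have e2 := fun G => level_le_normDev_iff hp0 G W ε
  rw [hU] at e1
  rw [hW] at e2
  simp_rw [e1, e2]
  refine (binomialRandom_real_commonDegree_ge_and p hUW _).trans ?_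
  rw [hU, hW, Fintype.card_fin, ← sq]
  exact pow_le_pow_left₀ (binTail_nonneg (by positivity) (pow_le_one₀ h0.le p.2.2) _ _) h 2

/-- A near-maximal `U` does not force its subsets to be exceptional: the typical deviation it
imposes on an `s`-subset stays below the exceptional level. -/
lemma level_mul_div_lt (hp0 : 0 < p) (hp1 : p < 1) {s k : ℕ} (hs : 0 < s) (hk : s < k) {ε : ℝ}
    (hε0 : 0 < ε) (hε1 : ε < 1) :
    level p k (-ε) * relVar p s / relVar p k < level p s ε := by
  have h1 := relVar_pos hp0 hp1 hs
  have h2 := relVar_pos hp0 hp1 (hs.trans hk)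
  have h3 := mul_relVar_lt hp0 hp1 hs hk
  have hs' : (0 : ℝ) < s := by exact_mod_cast hs
  refine lt_of_pow_lt_pow_left₀ 2 (level_nonneg (by linarith)) ?_
  rw [div_pow, mul_pow, level_sq hp0 hp1, level_sq hp0 hp1, div_lt_iff₀ (by positivity)]
  have e1 : (1 + -ε) ^ 2 ≤ (1 + ε) ^ 2 := by nlinarith
  calc (1 + -ε) ^ 2 * (2 * k * relVar p k) * relVar p s ^ 2
      ≤ (1 + ε) ^ 2 * (2 * k * relVar p k) * relVar p s ^ 2 := by gcongr
    _ = (1 + ε) ^ 2 * (2 * relVar p k * relVar p s) * (k * relVar p s) := by ring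
    _ < (1 + ε) ^ 2 * (2 * relVar p k * relVar p s) * (s * relVar p k) := by gcongr
    _ = _ := by ring

/-- `U` has a nonempty proper subset with exceptionally many common neighbours. -/
def hasExceptionalSubset (p : unitInterval) (ε : ℝ) {n : ℕ} (U : Finset (Fin n)) :
    Set (SimpleGraph (Fin n)) :=
  {G | ∃ S, S ⊂ U ∧ S.Nonempty ∧ level p S.card ε * devScale n ≤ normDev p G S}

lemma eventually_exceptional_le (hp0 : 0 < p) (hp1 : p < 1) {k : ℕ} {ε : ℝ}
    (hε0 : 0 < ε) (hε1 : ε < 1) {η : ℝ} (hη : 0 < η) :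
    ∀ᶠ n : ℕ in atTop, ∀ U : Finset (Fin n), U.card = k →
      (binomialRandom (Fin n) p).real
        ({G | level p k (-ε) * devScale n ≤ normDev p G U} ∩ hasExceptionalSubset p ε U) ≤
        η * hitProb p k ε n := by
  have hs : ∀ s < k, ∀ᶠ n : ℕ in atTop, 0 < s → ∀ U S : Finset (Fin n), U.card = k → S ⊆ U →
      S.card = s → (binomialRandom (Fin n) p).real
        {G | level p k (-ε) * devScale n ≤ normDev p G U ∧
          level p s ε * devScale n ≤ normDev p G S} ≤ η / 2 ^ k * hitProb p k ε n := by
    intro s hsk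
    rcases s.eq_zero_or_pos with rfl | hs
    · simp
    have hk := hs.trans hsk
    have hlt := level_mul_div_lt hp0 hp1 hs hsk hε0 hε1
    have hf := relVar_pos hp0 hp1 hs
    set gap := (level p s ε - level p k (-ε) * relVar p s / relVar p k) ^ 2 / (2 * relVar p s)
      with hgap
    have hgap0 : 0 < gap := by
      have := sub_pos.2 hlt
      positivity
    -- A quarter of the gap is lost in the upper bound and a quarter in the lower bound on
    -- `hitProb`, leaving a factor `n ^ (-(gap / 2))`.
    have h1 := eventually_dev_ge_and_subset_le hp0 hp1 hs hsk (u := level p k (-ε))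
      (level_nonneg (by linarith)) hlt.le (η := gap / 4) (by linarith)
    have h2 := eventually_le_hitProb hp0 hp1 hk hε1.le (η := gap / 4) (by linarith)
    have hlim : Tendsto (fun n : ℕ => (n : ℝ) ^ (-(gap / 2))) atTop (𝓝 0) :=
      (tendsto_rpow_neg_atTop (by linarith)).comp tendsto_natCast_atTop_atTop
    filter_upwards [h1, h2, hlim.eventually_lt_const (show 0 < η / 2 ^ k by positivity),
      eventually_gt_atTop 0] with n h1 h2 h3 hn _ U S hU hSU hS
    have hn0 : (0 : ℝ) < n := by exact_mod_cast hn
    refine (h1 U S hU hSU hS).trans ?_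
    rw [level_sq_div hp0 hp1 hk, ← sub_eq_add_neg]
    calc (n : ℝ) ^ (-(k * (1 - ε) ^ 2 + gap - gap / 4))
        = (n : ℝ) ^ (-(gap / 2)) * (n : ℝ) ^ (-(k * (1 - ε) ^ 2 + gap / 4)) := by
          rw [← Real.rpow_add hn0]
          congr 1
          ring
      _ ≤ _ := mul_le_mul h3.le h2 (by positivity) (by positivity)
  filter_upwards [(eventually_all_finite (Set.finite_Iio k)).2 hs] with n h U hU
  have hsub : {G | level p k (-ε) * devScale n ≤ normDev p G U} ∩ hasExceptionalSubset p ε U ⊆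
      ⋃ S ∈ U.powerset.filter fun S => S ⊂ U ∧ S.Nonempty,
        {G | level p k (-ε) * devScale n ≤ normDev p G U ∧
          level p S.card ε * devScale n ≤ normDev p G S} := by
    rintro G ⟨h1, S, h2, h3, h4⟩
    simp only [Set.mem_iUnion]
    exact ⟨S, by simp [h2, h3, h2.subset], h1, h4⟩
  refine (measureReal_mono hsub (measure_ne_top _ _)).trans ((measureReal_biUnion_finset_le _ _).trans ?_)
  calc _ ≤ ∑ S ∈ U.powerset.filter fun S => S ⊂ U ∧ S.Nonempty,
        η / 2 ^ k * hitProb p k ε n := by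
        refine Finset.sum_le_sum fun S hS => ?_
        obtain ⟨-, h1, h2⟩ := Finset.mem_filter.1 hS
        exact h S.card (by simpa [hU] using Finset.card_lt_card h1) h2.card_pos U S hU h1.subset rfl
    _ ≤ ∑ S ∈ U.powerset, η / 2 ^ k * hitProb p k ε n := by
        refine Finset.sum_le_sum_of_subset_of_nonneg (Finset.filter_subset _ _) fun _ _ _ => ?_
        exact mul_nonneg (by positivity) (hitProb_nonneg _ _ _)
    _ = _ := by
        rw [Finset.sum_const, Finset.card_powerset, hU, nsmul_eq_mul]
        push_cast
        field_simp
end SimpleGraph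

/-! ### Second moment method for the number of hits. -/

lemma measureReal_count_le_mul_sq_le {Ω ι : Type*} [MeasurableSpace Ω] [DiscreteMeasurableSpace Ω]
    [Finite Ω] (μ : Measure Ω) [IsProbabilityMeasure μ] (F : Finset ι) (G : ι → Set Ω) {c : ℝ}
    (hc : c ≤ ∑ i ∈ F, μ.real (G i)) :
    μ.real {ω | ∑ i ∈ F, (G i).indicator 1 ω ≤ c} * (∑ i ∈ F, μ.real (G i) - c) ^ 2 ≤
      ∑ i ∈ F, ∑ j ∈ F, μ.real (G i ∩ G j) - (∑ i ∈ F, μ.real (G i)) ^ 2 := by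
  set m := ∑ i ∈ F, μ.real (G i) with hm
  set X : Ω → ℝ := fun ω => ∑ i ∈ F, (G i).indicator 1 ω with hX
  have h1 : ∫ ω, X ω ∂μ = m := by
    rw [hX, integral_finsetSum _ fun i _ => .of_finite]
    exact Finset.sum_congr rfl fun i _ => integral_indicator_one .of_discrete
  have h2 : ∫ ω, X ω ^ 2 ∂μ = ∑ i ∈ F, ∑ j ∈ F, μ.real (G i ∩ G j) := by
    simp_rw [hX, sq, Finset.sum_mul_sum]
    rw [integral_finsetSum _ fun i _ => .of_finite]
    refine Finset.sum_congr rfl fun i _ => ?_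
    rw [integral_finsetSum _ fun i _ => .of_finite]
    refine Finset.sum_congr rfl fun j _ => ?_
    rw [← integral_indicator_one .of_discrete, Set.inter_indicator_one]
    rfl
  have h3 : ∫ ω, (X ω - m) ^ 2 ∂μ = ∑ i ∈ F, ∑ j ∈ F, μ.real (G i ∩ G j) - m ^ 2 := by
    have : ∀ ω, (X ω - m) ^ 2 = X ω ^ 2 - 2 * m * X ω + m ^ 2 := fun ω => by ring
    simp_rw [this]
    rw [integral_add .of_finite .of_finite, integral_sub .of_finite .of_finite,
      integral_const_mul, h1, h2]
    simp
    ring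
  rw [← h3, ← integral_indicator_one .of_discrete, ← integral_mul_const]
  -- Chebyshev, pointwise: where `X ω ≤ c ≤ m`, one has `(m - c) ^ 2 ≤ (X ω - m) ^ 2`.
  refine integral_mono .of_finite .of_finite fun ω => ?_
  by_cases hω : ω ∈ {ω | X ω ≤ c}
  · have h4 : X ω ≤ c := hω
    rw [Set.indicator_of_mem hω]
    simp only [Pi.one_apply, one_mul]
    nlinarith
  · rw [Set.indicator_of_notMem hω]
    simp only [zero_mul]
    positivity

namespace SimpleGraph
open Filter
variable {p : unitInterval}

/-- `U` has nearly maximal common degree and none of its nonempty proper subsets is exceptional. -/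
def goodHit (p : unitInterval) (k : ℕ) (ε : ℝ) {n : ℕ} (U : Finset (Fin n)) :
    Set (SimpleGraph (Fin n)) :=
  {G | level p k (-ε) * devScale n ≤ normDev p G U} \ hasExceptionalSubset p ε U

/-- About `n ^ k` sets each hit with exponent close to `k (1 - ε)²`, which is below `k`. -/
lemma tendsto_choose_mul_hitProb (hp0 : 0 < p) (hp1 : p < 1) {k : ℕ} (hk : 0 < k) {ε : ℝ}
    (hε0 : 0 < ε) (hε1 : ε < 1) :
    Tendsto (fun n : ℕ => (n.choose k : ℝ) * hitProb p k ε n) atTop atTop := by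
  have hk' : (0 : ℝ) < k := by exact_mod_cast hk
  set δ := k * (1 - (1 - ε) ^ 2) / 2 with hδ
  have hδ0 : 0 < δ := by
    have : 0 < 1 - (1 - ε) ^ 2 := by nlinarith
    positivity
  have hlim : Tendsto (fun n : ℕ => (2 ^ k * (k.factorial : ℝ))⁻¹ * (n : ℝ) ^ δ) atTop atTop :=
    ((tendsto_rpow_atTop hδ0).comp tendsto_natCast_atTop_atTop).const_mul_atTop (by positivity)
  refine tendsto_atTop_mono' _ ?_ hlim
  filter_upwards [eventually_le_hitProb hp0 hp1 hk hε1.le hδ0, eventually_ge_atTop (2 * k)]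
    with n h hn
  have hn0 : (0 : ℝ) < n := by
    have : 0 < n := by omega
    exact_mod_cast this
  have hch : (2 ^ k * (k.factorial : ℝ))⁻¹ * (n : ℝ) ^ k ≤ n.choose k := by
    refine le_trans ?_ (Nat.pow_le_choose k n)
    have e : (2 ^ k * (k.factorial : ℝ))⁻¹ * (n : ℝ) ^ k = ((n : ℝ) / 2) ^ k / k.factorial := by
      rw [div_pow]
      field_simp
    rw [e]
    gcongr
    rw [div_le_iff₀ (by norm_num)]
    have : n ≤ (n + 1 - k) * 2 := by omega
    exact_mod_cast this
  calc (2 ^ k * (k.factorial : ℝ))⁻¹ * (n : ℝ) ^ δ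
      = (2 ^ k * (k.factorial : ℝ))⁻¹ * (n : ℝ) ^ k * (n : ℝ) ^ (-(k * (1 - ε) ^ 2 + δ)) := by
        rw [mul_assoc, ← Real.rpow_natCast (n : ℝ) k, ← Real.rpow_add hn0]
        congr 2
        rw [hδ]
        ring
    _ ≤ _ := mul_le_mul hch h (by positivity) (by positivity)

/-- Disjoint pairs give the square of the mean up to `1 + η`, equal pairs give the mean. For other
pairs, excluding exceptional subsets makes the pair a `badPair`, and those sum to at most `1`. -/
lemma eventually_sum_goodHit_inter_le (hp0 : 0 < p) (hp1 : p < 1) {k : ℕ} (hk : 0 < k) {ε : ℝ}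
    (hε1 : ε < 1)
    (hmargin : ∀ s, 0 < s → s < k → level p s ε ≤ level p k (-ε) ∧
      (k : ℝ) + k - s < k * (1 - ε) ^ 2 +
        (level p k (-ε) - level p s ε) ^ 2 / (2 * (relVar p k - relVar p s)))
    {η : ℝ} (hη : 0 < η) :
    ∀ᶠ n : ℕ in atTop, ∑ U ∈ Finset.powersetCard k (Finset.univ : Finset (Fin n)),
      ∑ W ∈ Finset.powersetCard k (Finset.univ : Finset (Fin n)),
        (binomialRandom (Fin n) p).real (goodHit p k ε U ∩ goodHit p k ε W) ≤
      ((1 + η) * (n.choose k * hitProb p k ε n)) ^ 2 + n.choose k * hitProb p k ε n + 1 := by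
  have hpairs : Tendsto (fun n : ℕ => ∑ s ∈ Finset.Ioo 0 k,
      ∑ x ∈ intersectingPairs (Fin n) k k s,
        (binomialRandom (Fin n) p).real (badPair p ε x.1 x.2)) atTop (𝓝 0) := by
    have := tendsto_finsetSum (Finset.Ioo 0 k) fun s hs => by
      obtain ⟨h1, h2⟩ := Finset.mem_Ioo.1 hs
      exact tendsto_sum_badPair hp0 hp1 h1 h2.le h2 hε1.le (hmargin s h1 h2).1 (hmargin s h1 h2).2
    simpa using this
  filter_upwards [hpairs.eventually_le_const (zero_lt_one), eventually_disjoint_le hp0 hp1 hk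
    hε1.le hη] with n hpairs hdisj
  set F := Finset.powersetCard k (Finset.univ : Finset (Fin n)) with hF
  have hcardF : (F.card : ℝ) = n.choose k := by simp [hF]
  have hmemF : ∀ U, U ∈ F ↔ U.card = k := by simp [hF, Finset.mem_powersetCard]
  set μ := (binomialRandom (Fin n) p) with hμ
  have hgood : ∀ U ∈ F, μ.real (goodHit p k ε U) ≤ hitProb p k ε n := by
    intro U hU
    rw [← binomialRandom_real_level_le hp0 ((hmemF U).1 hU)]
    exact measureReal_mono Set.sdiff_subset
  have hterm : ∀ U ∈ F, ∀ W ∈ F, μ.real (goodHit p k ε U ∩ goodHit p k ε W) ≤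
      ((1 + η) * hitProb p k ε n) ^ 2 + (if U = W then hitProb p k ε n else 0) +
      ∑ s ∈ Finset.Ioo 0 k, if (U ∩ W).card = s then μ.real (badPair p ε U W) else 0 := by
    intro U hU W hW
    have hUk := (hmemF U).1 hU
    have hWk := (hmemF W).1 hW
    have n1 : 0 ≤ ((1 + η) * hitProb p k ε n) ^ 2 := sq_nonneg _
    have n2 : (0 : ℝ) ≤ if U = W then hitProb p k ε n else 0 := by
      split_ifs
      exacts [hitProb_nonneg _ _ _, le_rfl]
    have n3 : 0 ≤ ∑ s ∈ Finset.Ioo 0 k,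
        if (U ∩ W).card = s then μ.real (badPair p ε U W) else 0 :=
      Finset.sum_nonneg fun s _ => by split_ifs; exacts [measureReal_nonneg, le_rfl]
    by_cases hUW : U = W
    · have : μ.real (goodHit p k ε U ∩ goodHit p k ε W) ≤ hitProb p k ε n :=
        (measureReal_mono Set.inter_subset_left).trans (hgood U hU)
      rw [if_pos hUW] at n2 ⊢
      linarith
    by_cases hd : Disjoint U W
    · have : μ.real (goodHit p k ε U ∩ goodHit p k ε W) ≤ ((1 + η) * hitProb p k ε n) ^ 2 := by
        refine le_trans (measureReal_mono ?_) (hdisj U W hUk hWk hd)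
        exact fun G hG => ⟨hG.1.1, hG.2.1⟩
      linarith
    · have hne : (U ∩ W).Nonempty := Finset.not_disjoint_iff_nonempty_inter.1 hd
      have hss : U ∩ W ⊂ U := by
        refine Finset.inter_subset_left.ssubset_of_ne fun h => hUW ?_
        exact Finset.eq_of_subset_of_card_le (Finset.inter_eq_left.1 h) (by omega)
      have hs : (U ∩ W).card ∈ Finset.Ioo 0 k :=
        Finset.mem_Ioo.2 ⟨hne.card_pos, by simpa [hUk] using Finset.card_lt_card hss⟩
      have : μ.real (goodHit p k ε U ∩ goodHit p k ε W) ≤ μ.real (badPair p ε U W) := by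
        refine measureReal_mono fun G hG => ?_
        refine ⟨by rw [hUk]; exact hG.1.1, by rw [hWk]; exact hG.2.1, ?_⟩
        by_contra hcon
        exact hG.1.2 ⟨U ∩ W, hss, hne, (not_le.1 hcon).le⟩
      rw [Finset.sum_ite_eq, if_pos hs] at n3 ⊢
      linarith
  calc _ ≤ ∑ U ∈ F, ∑ W ∈ F, (((1 + η) * hitProb p k ε n) ^ 2 +
        (if U = W then hitProb p k ε n else 0) +
        ∑ s ∈ Finset.Ioo 0 k, if (U ∩ W).card = s then μ.real (badPair p ε U W) else 0) :=
        Finset.sum_le_sum fun U hU => Finset.sum_le_sum fun W hW => hterm U hU W hW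
    _ = (F.card : ℝ) ^ 2 * ((1 + η) * hitProb p k ε n) ^ 2 + F.card * hitProb p k ε n +
        ∑ s ∈ Finset.Ioo 0 k, ∑ x ∈ intersectingPairs (Fin n) k k s,
          μ.real (badPair p ε x.1 x.2) := by
        simp only [Finset.sum_add_distrib]
        congr 1
        · congr 1
          · simp only [Finset.sum_const, nsmul_eq_mul]
            ring
          · rw [Finset.sum_congr rfl fun U hU => (Finset.sum_ite_eq F U _).trans (if_pos hU)]
            simp
        · simp_rw [intersectingPairs, Finset.sum_filter]
          rw [← Finset.sum_product', Finset.sum_comm]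
    _ ≤ _ := by
        rw [hcardF]
        have e : (n.choose k : ℝ) ^ 2 * ((1 + η) * hitProb p k ε n) ^ 2 =
          ((1 + η) * (n.choose k * hitProb p k ε n)) ^ 2 := by ring
        rw [e]
        linarith

lemma tendsto_few_hits (hp0 : 0 < p) (hp1 : p < 1) {k : ℕ} (hk : 0 < k) {ε : ℝ}
    (hε0 : 0 < ε) (hε1 : ε < 1)
    (hmargin : ∀ s, 0 < s → s < k → level p s ε ≤ level p k (-ε) ∧
      (k : ℝ) + k - s < k * (1 - ε) ^ 2 +
        (level p k (-ε) - level p s ε) ^ 2 / (2 * (relVar p k - relVar p s))) (m : ℕ) :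
    Tendsto (fun n : ℕ => (binomialRandom (Fin n) p).real
      {G | {U : Finset (Fin n) | U.card = k ∧
        level p k (-ε) * devScale n ≤ normDev p G U}.ncard ≤ m}) atTop (𝓝 0) := by
  rw [tendsto_order]
  refine ⟨fun a ha => Eventually.of_forall fun n => ha.trans_le measureReal_nonneg, fun a ha => ?_⟩
  -- With `A ≥ 8 m` and `η ≤ 1 / 8` the gap `M - m` is at least `A / 2`; with `A ≥ 2 / η` the
  -- variance is at most `5 η A²`. Hence `P ≤ 20 η ≤ a / 2`.
  set η := min (1 / 8) (a / 40) with hη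
  have hη0 : 0 < η := by positivity
  have hη1 : η ≤ 1 / 8 := min_le_left _ _
  have hη2 : η ≤ a / 40 := min_le_right _ _
  filter_upwards [eventually_sum_goodHit_inter_le hp0 hp1 hk hε1 hmargin hη0,
    eventually_exceptional_le hp0 hp1 (k := k) hε0 hε1 hη0,
    (tendsto_choose_mul_hitProb hp0 hp1 hk hε0 hε1).eventually_ge_atTop
      (max (8 * (m : ℝ)) (2 / η))] with n hB hE hA
  set A := (n.choose k : ℝ) * hitProb p k ε n with hAdef
  have hA1 : 8 * (m : ℝ) ≤ A := (le_max_left _ _).trans hA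
  have hA2 : 2 / η ≤ A := (le_max_right _ _).trans hA
  rw [div_le_iff₀ hη0] at hA2
  have hA0 : 1 ≤ A := by nlinarith
  set F := Finset.powersetCard k (Finset.univ : Finset (Fin n)) with hF
  have hmemF : ∀ U, U ∈ F ↔ U.card = k := by simp [hF, Finset.mem_powersetCard]
  set μ := (binomialRandom (Fin n) p) with hμ
  have hmean : (1 - η) * A ≤ ∑ U ∈ F, μ.real (goodHit p k ε U) := by
    have : ∀ U ∈ F, (1 - η) * hitProb p k ε n ≤ μ.real (goodHit p k ε U) := by
      intro U hU
      have hUk := (hmemF U).1 hU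
      have h1 := measureReal_sdiff_add_inter (μ := μ)
        (s := {G | level p k (-ε) * devScale n ≤ normDev p G U})
        (t := hasExceptionalSubset p ε U) .of_discrete
      rw [binomialRandom_real_level_le hp0 hUk] at h1
      have h2 := hE U hUk
      change _ ≤ μ.real (_ \ _)
      linarith
    calc (1 - η) * A = ∑ U ∈ F, (1 - η) * hitProb p k ε n := by
          simp [hF, hAdef]; ring
      _ ≤ _ := Finset.sum_le_sum this
  set M := ∑ U ∈ F, μ.real (goodHit p k ε U) with hM
  have hmM : (m : ℝ) ≤ M := by nlinarith
  have hcheb := measureReal_count_le_mul_sq_le μ F (goodHit p k ε) (c := m) hmM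
  have hsub : μ.real {G | {U : Finset (Fin n) | U.card = k ∧
        level p k (-ε) * devScale n ≤ normDev p G U}.ncard ≤ m} ≤
      μ.real {G | ∑ U ∈ F, (goodHit p k ε U).indicator 1 G ≤ (m : ℝ)} := by
    classical
    refine measureReal_mono fun G hG => ?_
    simp only [Set.mem_ofPred_eq] at hG ⊢
    have e : ∑ U ∈ F, (goodHit p k ε U).indicator 1 G =
        ((F.filter fun U => G ∈ goodHit p k ε U).card : ℝ) := by
      rw [← Finset.sum_boole]
      exact Finset.sum_congr rfl fun U _ => by simp [Set.indicator_apply]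
    rw [e, Nat.cast_le, ← Set.ncard_coe_finset]
    refine (Set.ncard_le_ncard (fun U hU => ?_) (Set.toFinite _)).trans hG
    obtain ⟨h1, h2⟩ := Finset.mem_filter.1 (Finset.mem_coe.1 hU)
    exact ⟨(hmemF U).1 h1, h2.1⟩
  refine hsub.trans_lt ?_
  set P := μ.real {G | ∑ U ∈ F, (goodHit p k ε U).indicator 1 G ≤ (m : ℝ)} with hP
  have hgap : A / 2 ≤ M - m := by nlinarith
  have hP0 : 0 ≤ P := measureReal_nonneg
  have h1 : P * (A / 2) ^ 2 ≤ P * (M - m) ^ 2 := by gcongr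
  have h2 : ((1 - η) * A) ^ 2 ≤ M ^ 2 := by
    have : 0 ≤ (1 - η) * A := mul_nonneg (by linarith) (by linarith)
    gcongr
  have h3 : P * (A / 2) ^ 2 ≤ ((1 + η) * A) ^ 2 + A + 1 - ((1 - η) * A) ^ 2 := by linarith
  have h4 : P * (A / 2) ^ 2 ≤ 5 * η * A ^ 2 := by nlinarith
  have h5 : P ≤ 20 * η := by
    have hA2' : 0 < A ^ 2 := by positivity
    nlinarith
  linarith
end SimpleGraph

/-! ### From near-maximal sets to top families. -/

namespace SimpleGraph
open Filter
variable {p : unitInterval}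

lemma normDev_le_normDev (hp0 : 0 < p) {V : Type*} [Fintype V] {G : SimpleGraph V}
    {U W : Finset V} (hcard : W.card = U.card) (h : G.commonDegree W ≤ G.commonDegree U) :
    normDev p G W ≤ normDev p G U := by
  have h0 : (0 : ℝ) < p := hp0
  unfold normDev
  rw [hcard]
  gcongr

/-- If more than `m` sets of size `k` have nearly maximal common degree, then so do all members of
every top family. -/
lemma IsTopFamily.level_le (hp0 : 0 < p) {n k m : ℕ} {G : SimpleGraph (Fin n)}
    {U : Fin m → Finset (Fin n)} (hU : G.IsTopFamily k m U) {x : ℝ}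
    (h : m < {W : Finset (Fin n) | W.card = k ∧ x ≤ normDev p G W}.ncard) (j : Fin m) :
    x ≤ normDev p G (U j) := by
  by_contra hj
  -- If `U j` misses the level, so does every `k`-set outside the family; then more than `m` hits
  -- would have to fit among `m` sets.
  have hsub : {W : Finset (Fin n) | W.card = k ∧ x ≤ normDev p G W} ⊆ Set.range U := by
    rintro W ⟨hW, hx⟩
    by_contra hW'
    exact hj (hx.trans (normDev_le_normDev hp0 (hW.trans (hU.card_eq j).symm)
      (hU.le_of_notMem W hW hW' j)))
  have h1 := Set.ncard_le_ncard hsub (Set.toFinite _)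
  rw [Set.ncard_range_of_injective hU.injective, Nat.card_eq_fintype_card, Fintype.card_fin] at h1
  omega

/-- The triples `(k, l, s)` with `0 < s ≤ k` and `s < l` and entries at most `K`. -/
def overlapTriples (K : ℕ) : Finset (ℕ × ℕ × ℕ) :=
  (Finset.range (K + 1) ×ˢ Finset.range (K + 1) ×ˢ Finset.range (K + 1)).filter
    fun t => 0 < t.2.2 ∧ t.2.2 ≤ t.1 ∧ t.2.2 < t.2.1

lemma mem_overlapTriples {K k l s : ℕ} : (k, l, s) ∈ overlapTriples K ↔
    k ≤ K ∧ l ≤ K ∧ 0 < s ∧ s ≤ k ∧ s < l := by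
  simp only [overlapTriples, Finset.mem_filter, Finset.mem_product, Finset.mem_range]
  omega

/-- Some nonempty set of size at most `K` has an exceptionally large common degree. -/
def exceptionalEvent (p : unitInterval) (K : ℕ) (ε : ℝ) (n : ℕ) : Set (SimpleGraph (Fin n)) :=
  ⋃ s ∈ Finset.Ioc 0 K, ⋃ S ∈ Finset.powersetCard s (Finset.univ : Finset (Fin n)),
    {G | level p s ε * devScale n ≤ normDev p G S}

/-- Some pair of intersecting sets of size at most `K` is bad. -/
def badPairEvent (p : unitInterval) (K : ℕ) (ε : ℝ) (n : ℕ) : Set (SimpleGraph (Fin n)) :=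
  ⋃ t ∈ overlapTriples K, ⋃ x ∈ intersectingPairs (Fin n) t.1 t.2.1 t.2.2, badPair p ε x.1 x.2

/-- At most `m` sets of size `k` have nearly maximal common degree. -/
def fewHitsEvent (p : unitInterval) (k m : ℕ) (ε : ℝ) (n : ℕ) : Set (SimpleGraph (Fin n)) :=
  {G | {U : Finset (Fin n) | U.card = k ∧
    level p k (-ε) * devScale n ≤ normDev p G U}.ncard ≤ m}

lemma tendsto_exceptionalEvent (hp0 : 0 < p) (hp1 : p < 1) (K : ℕ) {ε : ℝ} (hε : 0 < ε) :
    Tendsto (fun n : ℕ => (binomialRandom (Fin n) p).real (exceptionalEvent p K ε n))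
      atTop (𝓝 0) := by
  have h := tendsto_finsetSum (Finset.Ioc 0 K) fun s hs =>
    tendsto_sum_dev_ge hp0 hp1 (Finset.mem_Ioc.1 hs).1 hε
  simp only [Finset.sum_const_zero] at h
  refine squeeze_zero (fun n => measureReal_nonneg) (fun n => ?_) h
  exact (measureReal_biUnion_finset_le _ _).trans
    (Finset.sum_le_sum fun s _ => measureReal_biUnion_finset_le _ _)

lemma tendsto_badPairEvent (hp0 : 0 < p) (hp1 : p < 1) {K : ℕ} {ε : ℝ} (hε1 : ε < 1)
    (hmargin : ∀ k ≤ K, ∀ l ≤ K, ∀ s, 0 < s → s < l →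
      level p s ε ≤ level p l (-ε) ∧
      (k : ℝ) + l - s < k * (1 - ε) ^ 2 +
        (level p l (-ε) - level p s ε) ^ 2 / (2 * (relVar p l - relVar p s))) :
    Tendsto (fun n : ℕ => (binomialRandom (Fin n) p).real (badPairEvent p K ε n))
      atTop (𝓝 0) := by
  have h := tendsto_finsetSum (overlapTriples K) fun t ht => by
    obtain ⟨h1, h2, h3, h4, h5⟩ := mem_overlapTriples.1 ht
    have hm := hmargin t.1 h1 t.2.1 h2 t.2.2 h3 h5
    exact tendsto_sum_badPair hp0 hp1 h3 h4 h5 hε1.le hm.1 hm.2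
  simp only [Finset.sum_const_zero] at h
  refine squeeze_zero (fun n => measureReal_nonneg) (fun n => ?_) h
  exact (measureReal_biUnion_finset_le _ _).trans
    (Finset.sum_le_sum fun s _ => measureReal_biUnion_finset_le _ _)

lemma disjoint_of_hits {K n : ℕ} {ε : ℝ} {G : SimpleGraph (Fin n)}
    (hE : G ∉ exceptionalEvent p K ε n) (hB : G ∉ badPairEvent p K ε n) {U W : Finset (Fin n)}
    (hUK : U.card ≤ K) (hWK : W.card ≤ K) (hne : U ≠ W)
    (hU : level p U.card (-ε) * devScale n ≤ normDev p G U)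
    (hW : level p W.card (-ε) * devScale n ≤ normDev p G W) : Disjoint U W := by
  have key : ∀ {U W : Finset (Fin n)}, U.card ≤ K → W.card ≤ K → ¬ W ⊆ U →
      level p U.card (-ε) * devScale n ≤ normDev p G U →
      level p W.card (-ε) * devScale n ≤ normDev p G W → Disjoint U W := by
    intro U W hUK hWK hWU hU hW
    by_contra hd
    have hpos : 0 < (U ∩ W).card := (Finset.not_disjoint_iff_nonempty_inter.1 hd).card_pos
    have hle : (U ∩ W).card ≤ U.card := Finset.card_le_card Finset.inter_subset_left
    have hlt : (U ∩ W).card < W.card := by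
      refine Finset.card_lt_card (Finset.inter_subset_right.ssubset_of_ne fun h => hWU ?_)
      exact Finset.inter_eq_right.1 h
    apply hB
    simp only [badPairEvent, Set.mem_iUnion]
    refine ⟨(U.card, W.card, (U ∩ W).card), mem_overlapTriples.2 ⟨hUK, hWK, hpos, hle, hlt⟩,
      (U, W), mem_intersectingPairs.2 ⟨rfl, rfl, rfl⟩, hU, hW, ?_⟩
    by_contra hcon
    apply hE
    simp only [exceptionalEvent, Set.mem_iUnion]
    exact ⟨(U ∩ W).card, Finset.mem_Ioc.2 ⟨hpos, hle.trans hUK⟩, U ∩ W,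
      Finset.mem_powersetCard.2 ⟨Finset.subset_univ _, rfl⟩, (not_le.1 hcon).le⟩
  -- The bad-pair estimate needs the intersection to be proper in the second set. For nested sets
  -- the larger one takes that role.
  by_cases h : W ⊆ U
  · exact (key hWK hUK (fun h' => hne (h'.antisymm h)) hW hU).symm
  · exact key hUK hWK h hU hW

end SimpleGraph

theorem mainTheorem7 (p : unitInterval) (hp0 : 0 < p) (hp1 : p < 1)
    (r : ℕ) (k m : Fin r → ℕ) (hk : ∀ i, 0 < k i) (hm : ∀ i, 0 < m i)
    (hk_inj : Function.Injective k) :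
    Filter.Tendsto
      (fun n : ℕ => SimpleGraph.binomialRandom (Fin n) p
        {G : SimpleGraph (Fin n) | ∀ U : (i : Fin r) → Fin (m i) → Finset (Fin n),
          (∀ i, G.IsTopFamily (k i) (m i) (U i)) →
            Pairwise fun a b : (Σ i : Fin r, Fin (m i)) => Disjoint (U a.1 a.2) (U b.1 b.2)})
      Filter.atTop (𝓝 1) := by
  set K := Finset.univ.sup k with hK
  have hkK : ∀ i, k i ≤ K := fun i => Finset.le_sup (Finset.mem_univ i)
  obtain ⟨ε, hε0, hε1, hmargin⟩ := SimpleGraph.exists_level_margin hp0 hp1 K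
  have hfew := tendsto_finsetSum Finset.univ fun (i : Fin r) _ =>
    SimpleGraph.tendsto_few_hits hp0 hp1 (hk i) hε0 hε1
      (fun s h1 h2 => hmargin (k i) (hkK i) (k i) (hkK i) s h1 h2) (m i)
  have hbad := ((SimpleGraph.tendsto_exceptionalEvent hp0 hp1 K hε0).add
    (SimpleGraph.tendsto_badPairEvent hp0 hp1 hε1 hmargin)).add hfew
  simp only [Finset.sum_const_zero, add_zero] at hbad
  have hone := hbad.const_sub 1
  rw [sub_zero] at hone
  refine (ENNReal.tendsto_toReal_iff (fun n => measure_ne_top _ _) ENNReal.one_ne_top).1 ?_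
  rw [ENNReal.toReal_one]
  refine tendsto_of_tendsto_of_tendsto_of_le_of_le hone tendsto_const_nhds (fun n => ?_)
    fun n => measureReal_le_one
  set good := {G : SimpleGraph (Fin n) | ∀ U : (i : Fin r) → Fin (m i) → Finset (Fin n),
    (∀ i, G.IsTopFamily (k i) (m i) (U i)) →
      Pairwise fun a b : (Σ i : Fin r, Fin (m i)) => Disjoint (U a.1 a.2) (U b.1 b.2)}
  have hsub : goodᶜ ⊆ (SimpleGraph.exceptionalEvent p K ε n ∪ SimpleGraph.badPairEvent p K ε n) ∪
      ⋃ i ∈ (Finset.univ : Finset (Fin r)), SimpleGraph.fewHitsEvent p (k i) (m i) ε n := by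
    intro G hG
    by_contra hcon
    simp only [Set.mem_union, Set.mem_iUnion, Finset.mem_univ, exists_true_left, not_or,
      not_exists, SimpleGraph.fewHitsEvent, Set.mem_ofPred_eq, not_le] at hcon
    obtain ⟨⟨hE, hB⟩, hF⟩ := hcon
    refine hG fun U hU a b hab => ?_
    have hcard : ∀ i j, (U i j).card = k i := fun i => (hU i).card_eq
    have hhit : ∀ i j, SimpleGraph.level p (U i j).card (-ε) * SimpleGraph.devScale n ≤
        SimpleGraph.normDev p G (U i j) := by
      intro i j
      rw [hcard]
      exact (hU i).level_le hp0 (hF i) j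
    refine SimpleGraph.disjoint_of_hits hE hB ((hcard _ _).trans_le (hkK _))
      ((hcard _ _).trans_le (hkK _)) (fun h => hab ?_) (hhit _ _) (hhit _ _)
    obtain ⟨i, j⟩ := a
    obtain ⟨i', j'⟩ := b
    -- Equal sets have equal sizes, so distinctness of the `k i` forces a common index `i`, and
    -- injectivity within that family then gives `j = j'`.
    have hi : i = i' := hk_inj (by rw [← hcard i j, ← hcard i' j']; exact congrArg _ h)
    subst hi
    exact congrArg _ ((hU i).injective h)
  have hcompl : (SimpleGraph.binomialRandom (Fin n) p).real good =
      1 - (SimpleGraph.binomialRandom (Fin n) p).real goodᶜ := by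
    rw [probReal_compl_eq_one_sub .of_discrete]
    ring
  change _ ≤ (SimpleGraph.binomialRandom (Fin n) p).real good
  rw [hcompl]
  refine sub_le_sub_left ((measureReal_mono hsub).trans ?_) 1
  refine (measureReal_union_le _ _).trans (add_le_add (measureReal_union_le _ _) ?_)
  exact measureReal_biUnion_finset_le _ _
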